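/- Let $\mathrm{Gra}$ be the real vector space of formal sums of finite unoriented graphs $\gamma$ (no one-cycles, no multiple edges, unlabelled vertices) equipped with a wedge ordering $\mathsf E(\gamma)=I\wedge II\wedge\dots$ of edges; isomorphic graphs are identified, and a permutation of edges multiplies the graph by its sign. A bi-grading $(n,m)$ means a formal sum of connected graphs with $n$ vertices and $m$ edges. Let $\gamma_1\circ\gamma_2$ be the sum over vertices $v$ of $\gamma_2$ of insertions of $\gamma_1$ into $v$, the edges incident to $v$ being redirected to the vertices of $\gamma_1$ in all possible ways, with edges ordered as $\mathsf E(\gamma_1)\wedge\mathsf E(\gamma_2)$; put $[\gamma_1,\gamma_2]=\gamma_1\circ\gamma_2-(-1)^{\#\mathsf E(\gamma_1)\#\mathsf E(\gamma_2)}\gamma_2\circ\gamma_1$ and $\mathrm d=[\bullet\!\!-\!\!\bullet,\cdot\,]$. For multivector fields $\wp_1,\dots,\wp_n$ with smooth coefficients on $\mathbb R^d$, viewed as functions of the even coordinates $x^\alpha$ and the odd coordinates $\xi_\alpha$, and for a graph $\gamma$ on $n$ vertices, put $$\mathrm{Or}(\gamma)(\wp_1\otimes\dots\otimes\wp_n)=\frac1{n!}\sum_{\sigma\in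 S_n}\ \prod_{e_{ij}\in\mathsf E(\gamma)}\vec\Delta_{ij}\bigl(\wp_1|_{v_{\sigma(1)}}\cdots\wp_n|_{v_{\sigma(n)}}\bigr),\qquad \vec\Delta_{ij}=\sum_{\alpha=1}^d\Bigl(\frac{\partial}{\partial\xi^{(i)}_\alpha}\frac{\partial}{\partial x_{(j)}^\alpha}+\frac{\partial}{\partial x_{(i)}^\alpha}\frac{\partial}{\partial\xi^{(j)}_\alpha}\Bigr),$$ where the first edge acts first and all the copies of $(x,\xi)$ are identified in the end. Extend it linearly in $\gamma$ and write $\mathrm{Or}(\gamma)(P)$ when every $\wp_i$ equals $P$. Let $P$ be a Poisson bi-vector on $\mathbb R^d$, i.e. $[\![P,P]\!]=0$ for the Schouten bracket, let $\partial_P=[\![P,\cdot\,]\!]$, and let $Z=\ker\mathrm d\,\cap\,\bigoplus_{n\ge1}\mathrm{Gra}_{(n,2n-2)}$. Then the map $\gamma\mapsto\mathrm{Or}(\gamma)(P)$ from $Z$ to $\ker\partial_P$ is a Lie superalgebra morphism that takes the bracket of graphs to the commutator of flows. Explicitly: 1. $Z$ is closed under $[\cdot,\cdot]$, which takes bi-gradings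 $(n_1,2n_1-2)$ and $(n_2,2n_2-2)$ to $(n,2n-2)$ with $n=n_1+n_2-1$, and is skew-symmetric and satisfies the Jacobi identity on $Z$ (all elements of $Z$ are even). 2. The map $\gamma\mapsto\mathrm{Or}(\gamma)(P)$ is linear, and for every $\gamma\in Z$ the multivector $\mathrm{Or}(\gamma)(P)$ is a bi-vector with $[\![P,\mathrm{Or}(\gamma)(P)]\!]=0$. 3. For all $\gamma_1,\gamma_2\in Z$ and the flows $\frac{d}{d\varepsilon_i}(P)=Q_i(P)=\mathrm{Or}(\gamma_i)(P)$, $$\mathrm{Or}([\gamma_1,\gamma_2])(P)=\Bigl[\frac{d}{d\varepsilon_1},\frac{d}{d\varepsilon_2}\Bigr](P)=\frac{d}{d\varepsilon}\Big|_{\varepsilon=0}Q_2\bigl(P+\varepsilon Q_1(P)\bigr)-\frac{d}{d\varepsilon}\Big|_{\varepsilon=0}Q_1\bigl(P+\varepsilon Q_2(P)\bigr),$$ where the derivatives exist at every point of $\mathbb R^d$ and in every component. -/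

import Mathlib

open scoped TensorProduct ContDiff

noncomputable section

namespace GraphOr

/-! ## Unoriented graphs with wedge-ordered edges -/

/-- Possible edges of a graph on the vertex set `V`: unordered pairs of distinct vertices
(no one-cycles). -/
abbrev Edge (V : Type) : Type := {e : Sym2 V // ¬ e.IsDiag}

/-- Formal sums of graphs with labelled vertex set `V` and wedge-ordered edges.  The graph with
ordered edges `I, II, III, …` is the monomial `I ∧ II ∧ III ∧ …`; a transposition of two
edges changes the sign, and a graph with a multiple edge is zero. -/
abbrev LGra (V : Type) : Type := ExteriorAlgebra ℝ (Edge V →₀ ℝ)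

/-- The parity-odd generator of an edge. -/
def edgeGen {V : Type} (e : Edge V) : LGra V := ExteriorAlgebra.ι ℝ (Finsupp.single e 1)

/-- Image of an edge under an injective map of vertices. -/
def Edge.map {V W : Type} (f : V ↪ W) (e : Edge V) : Edge W :=
  ⟨e.1.map f, fun h => e.2 ((Sym2.isDiag_map f.injective).1 h)⟩

@[simp] theorem Edge.map_val {V W : Type} (f : V ↪ W) (e : Edge V) :
    (e.map f).1 = e.1.map f := rfl

/-- Transport of graphs along an injective map of vertices. -/
def push {V W : Type} (f : V ↪ W) : LGra V →ₐ[ℝ] LGra W :=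
  ExteriorAlgebra.map (Finsupp.lmapDomain ℝ ℝ (Edge.map f))

@[simp] theorem push_edgeGen {V W : Type} (f : V ↪ W) (e : Edge V) :
    push f (edgeGen e) = edgeGen (e.map f) := by
  simp [push, edgeGen, ExteriorAlgebra.map_apply_ι]

theorem lgra_hom_ext {V : Type} {A : Type*} [Semiring A] [Algebra ℝ A] {f g : LGra V →ₐ[ℝ] A}
    (h : ∀ e, f (edgeGen e) = g (edgeGen e)) : f = g := by
  apply ExteriorAlgebra.hom_ext
  apply Finsupp.lhom_ext'
  intro e
  apply LinearMap.ext_ring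
  exact h e

theorem push_push {V W X : Type} (f : V ↪ W) (g : W ↪ X) (x : LGra V) :
    push g (push f x) = push (f.trans g) x := by
  have : (push g).comp (push f) = push (f.trans g) := by
    apply lgra_hom_ext
    intro e
    simp only [AlgHom.comp_apply, push_edgeGen]
    congr 1
    apply Subtype.ext
    simp [Edge.map, Sym2.map_map]
  exact DFunLike.congr_fun this x

theorem push_refl {V : Type} (x : LGra V) : push (Function.Embedding.refl V) x = x := by
  have : push (Function.Embedding.refl V) = AlgHom.id ℝ _ := by
    apply lgra_hom_ext
    intro e
    simp only [push_edgeGen, AlgHom.id_apply]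
    congr 1
    apply Subtype.ext
    simp [Edge.map]
  exact DFunLike.congr_fun this x

/-- Relabelling of the vertices by permutations. -/
def relabel (V : Type) : Representation ℝ (Equiv.Perm V) (LGra V) where
  toFun σ := (push σ.toEmbedding).toLinearMap
  map_one' := by
    apply LinearMap.ext
    intro x
    exact push_refl x
  map_mul' σ τ := by
    apply LinearMap.ext
    intro x
    exact (push_push τ.toEmbedding σ.toEmbedding x).symm

theorem relabel_apply {V : Type} (σ : Equiv.Perm V) (x : LGra V) :
    relabel V σ x = push σ.toEmbedding x := rfl

/-- Formal sums of graphs with `n` unlabelled vertices. -/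
abbrev UGra (n : ℕ) : Type := (relabel (Fin n)).Coinvariants

/-- The real vector space of formal sums of finite graphs with wedge-ordered edges, without
one-cycles and multiple edges, graded by the number of vertices; isomorphic graphs are
identified (with the sign of the induced permutation of edges). -/
abbrev Gra : Type := DirectSum ℕ UGra

/-- The class of a graph with a finite vertex set `V`: forget the labels. -/
def unlabel (V : Type) [Fintype V] : LGra V →ₗ[ℝ] Gra :=
  DirectSum.lof ℝ ℕ UGra (Fintype.card V) ∘ₗ Representation.Coinvariants.mk _ ∘ₗ
    (push (Fintype.equivFin V).toEmbedding).toLinearMap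

theorem unlabel_eq {V : Type} [Fintype V] {n : ℕ} (e : V ≃ Fin n) (x : LGra V) :
    unlabel V x = DirectSum.lof ℝ ℕ UGra n (Representation.Coinvariants.mk _
      (push e.toEmbedding x)) := by
  have hn : Fintype.card V = n := by simpa using Fintype.card_congr e
  subst hn
  have h : push e.toEmbedding x = relabel _ ((Fintype.equivFin V).symm.trans e)
      (push (Fintype.equivFin V).toEmbedding x) := by
    rw [relabel_apply, push_push]
    congr 2
    ext v
    simp
  rw [h, Representation.Coinvariants.mk_self_apply]
  rfl

theorem unlabel_push {V W : Type} [Fintype V] [Fintype W] (f : V ≃ W) (x : LGra V) :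
    unlabel W (push f.toEmbedding x) = unlabel V x := by
  rw [unlabel_eq (Fintype.equivFin W), unlabel_eq (f.trans (Fintype.equivFin W)), push_push]
  rfl

/-- The graph with vertices `Fin n` and the list of edges `l`, ordered as in the list. -/
def graph (n : ℕ) (l : List (Edge (Fin n))) : Gra := unlabel (Fin n) (l.map edgeGen).prod

/-- The homogeneous component in bi-grading `(n, m)`: formal sums of connected graphs with `n`
vertices and `m` edges. -/
def homogeneous (n m : ℕ) : Submodule ℝ Gra :=
  Submodule.span ℝ {γ | ∃ l : List (Edge (Fin n)), l.length = m ∧ l.Nodup ∧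
    (SimpleGraph.fromEdgeSet {e | e ∈ l.map Subtype.val}).Connected ∧ γ = graph n l}

/-! ## Insertion of graphs and the graph bracket -/

/-- The vertex set obtained from `V₂` when its vertex `v` is replaced by `V₁`. -/
abbrev Blow (V₁ V₂ : Type) (v : V₂) : Type := V₁ ⊕ {w : V₂ // w ≠ v}

/-- The map of vertices that collapses `V₁` to `v`. -/
def collapse (V₁ : Type) {V₂ : Type} (v : V₂) : Blow V₁ V₂ v → V₂ :=
  Sum.elim (fun _ => v) Subtype.val

open Classical in
/-- Every edge `e` is replaced by the sum of all the edges that project to `e`.  For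
`π = collapse V₁ v` this redirects the edges incident to `v` to the vertices
of `V₁` in all possible ways. -/
def redirect {V W : Type} [Fintype W] (π : W → V) : LGra V →ₐ[ℝ] LGra W :=
  ExteriorAlgebra.map (Finsupp.linearCombination ℝ fun e : Edge V =>
    ∑ e' : Edge W with e'.1.map π = e.1, Finsupp.single e' (1 : ℝ))

open Classical in
theorem redirect_edgeGen {V W : Type} [Fintype W] (π : W → V) (e : Edge V) :
    redirect π (edgeGen e) = ∑ e' : Edge W with e'.1.map π = e.1, edgeGen e' := by
  simp [redirect, edgeGen, ExteriorAlgebra.map_apply_ι]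

theorem redirect_push {V V' W W' : Type} [Fintype W] [Fintype W'] (π : W → V) (π' : W' → V')
    (f : V ≃ V') (g : W ≃ W') (h : ∀ w, π' (g w) = f (π w)) (y : LGra V) :
    redirect π' (push f.toEmbedding y) = push g.toEmbedding (redirect π y) := by
  classical
  have : (redirect π').comp (push f.toEmbedding) = (push g.toEmbedding).comp (redirect π) := by
    apply lgra_hom_ext
    intro e
    simp only [AlgHom.comp_apply, push_edgeGen, redirect_edgeGen, map_sum]
    symm
    refine Finset.sum_bij (fun a _ => a.map g.toEmbedding) ?_ ?_ ?_ ?_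
    · intro a ha
      refine Finset.mem_filter.2 ⟨Finset.mem_univ _, ?_⟩
      rw [Edge.map_val, Edge.map_val, ← (Finset.mem_filter.1 ha).2, Sym2.map_map, Sym2.map_map]
      congr 1
      ext w
      exact h w
    · intro a _ b _ hab
      apply Subtype.ext
      exact Sym2.map.injective g.injective (congrArg Subtype.val hab)
    · intro b hb
      have hb := (Finset.mem_filter.1 hb).2
      rw [Edge.map_val] at hb
      refine ⟨b.map g.symm.toEmbedding, ?_, ?_⟩
      · refine Finset.mem_filter.2 ⟨Finset.mem_univ _, ?_⟩
        rw [Edge.map_val]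
        apply Sym2.map.injective f.injective
        rw [Sym2.map_map, Sym2.map_map]
        refine Eq.trans ?_ hb
        congr 1
        ext w
        simp [← h]
      · apply Subtype.ext
        simp [Edge.map, Sym2.map_map]
    · intro a _
      rfl
  exact DFunLike.congr_fun this y

/-- `x` inserted into the vertex `v` of `y`, edges ordered as `E(x) ∧ E(y)`. -/
def insertAt {V₁ V₂ : Type} [Fintype V₁] [Fintype V₂] [DecidableEq V₂] (v : V₂) :
    LGra V₁ →ₗ[ℝ] LGra V₂ →ₗ[ℝ] LGra (Blow V₁ V₂ v) :=
  (LinearMap.mul ℝ _).compl₁₂ (push Function.Embedding.inl).toLinearMap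
    (redirect (collapse V₁ v)).toLinearMap

/-- `x` inserted into the vertex `v` of `y`, edges ordered as `E(y) ∧ E(x)`. -/
def insertAt' {V₁ V₂ : Type} [Fintype V₁] [Fintype V₂] [DecidableEq V₂] (v : V₂) :
    LGra V₁ →ₗ[ℝ] LGra V₂ →ₗ[ℝ] LGra (Blow V₁ V₂ v) :=
  (LinearMap.mul ℝ _).flip.compl₁₂ (push Function.Embedding.inl).toLinearMap
    (redirect (collapse V₁ v)).toLinearMap

theorem insertAt_apply {V₁ V₂ : Type} [Fintype V₁] [Fintype V₂] [DecidableEq V₂] (v : V₂)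
    (x : LGra V₁) (y : LGra V₂) :
    insertAt v x y = push Function.Embedding.inl x * redirect (collapse V₁ v) y := rfl

theorem insertAt'_apply {V₁ V₂ : Type} [Fintype V₁] [Fintype V₂] [DecidableEq V₂] (v : V₂)
    (x : LGra V₁) (y : LGra V₂) :
    insertAt' v x y = redirect (collapse V₁ v) y * push Function.Embedding.inl x := rfl

/-- The bijection of the blown-up vertex sets induced by relabellings. -/
def blowEquiv {V₁ V₂ : Type} (σ : Equiv.Perm V₁) (τ : Equiv.Perm V₂) (v : V₂) :
    Blow V₁ V₂ v ≃ Blow V₁ V₂ (τ v) :=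
  Equiv.sumCongr σ (τ.subtypeEquiv fun a => by simp)

theorem blow_push {V₁ V₂ : Type} (σ : Equiv.Perm V₁) (τ : Equiv.Perm V₂) (v : V₂)
    (x : LGra V₁) :
    push (Function.Embedding.inl : V₁ ↪ Blow V₁ V₂ (τ v)) (push σ.toEmbedding x) =
      push (blowEquiv σ τ v).toEmbedding (push Function.Embedding.inl x) := by
  rw [push_push, push_push]
  rfl

theorem blow_redirect {V₁ V₂ : Type} [Fintype V₁] [Fintype V₂] [DecidableEq V₂]
    (σ : Equiv.Perm V₁) (τ : Equiv.Perm V₂) (v : V₂) (y : LGra V₂) :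
    redirect (collapse V₁ (τ v)) (push τ.toEmbedding y) =
      push (blowEquiv σ τ v).toEmbedding (redirect (collapse V₁ v) y) := by
  apply redirect_push
  rintro (w | w)
  · rfl
  · rfl

/-- The Leibniz-rule sum of insertions of `x` into the vertices of `y`, ordered `E(x) ∧ E(y)`. -/
def insertLab (n₁ n₂ : ℕ) : LGra (Fin n₁) →ₗ[ℝ] LGra (Fin n₂) →ₗ[ℝ] Gra :=
  ∑ v : Fin n₂, (insertAt v).compr₂ (unlabel (Blow (Fin n₁) (Fin n₂) v))

/-- The Leibniz-rule sum of insertions of `x` into the vertices of `y`, ordered `E(y) ∧ E(x)`. -/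
def insertLab' (n₁ n₂ : ℕ) : LGra (Fin n₁) →ₗ[ℝ] LGra (Fin n₂) →ₗ[ℝ] Gra :=
  ∑ v : Fin n₂, (insertAt' v).compr₂ (unlabel (Blow (Fin n₁) (Fin n₂) v))

theorem insertLab_apply (n₁ n₂ : ℕ) (x : LGra (Fin n₁)) (y : LGra (Fin n₂)) :
    insertLab n₁ n₂ x y = ∑ v, unlabel _ (insertAt v x y) := by
  simp [insertLab, LinearMap.sum_apply]

theorem insertLab'_apply (n₁ n₂ : ℕ) (x : LGra (Fin n₁)) (y : LGra (Fin n₂)) :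
    insertLab' n₁ n₂ x y = ∑ v, unlabel _ (insertAt' v x y) := by
  simp [insertLab', LinearMap.sum_apply]

theorem insertLab_relabel (n₁ n₂ : ℕ) (σ : Equiv.Perm (Fin n₁)) (τ : Equiv.Perm (Fin n₂))
    (x : LGra (Fin n₁)) (y : LGra (Fin n₂)) :
    insertLab n₁ n₂ (relabel _ σ x) (relabel _ τ y) = insertLab n₁ n₂ x y := by
  rw [insertLab_apply, insertLab_apply, ← Equiv.sum_comp τ]
  refine Finset.sum_congr rfl fun v _ => ?_
  rw [insertAt_apply, insertAt_apply, relabel_apply, relabel_apply, blow_push σ τ,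
    blow_redirect σ τ, ← map_mul, unlabel_push]

theorem insertLab'_relabel (n₁ n₂ : ℕ) (σ : Equiv.Perm (Fin n₁)) (τ : Equiv.Perm (Fin n₂))
    (x : LGra (Fin n₁)) (y : LGra (Fin n₂)) :
    insertLab' n₁ n₂ (relabel _ σ x) (relabel _ τ y) = insertLab' n₁ n₂ x y := by
  rw [insertLab'_apply, insertLab'_apply, ← Equiv.sum_comp τ]
  refine Finset.sum_congr rfl fun v _ => ?_
  rw [insertAt'_apply, insertAt'_apply, relabel_apply, relabel_apply, blow_push σ τ,
    blow_redirect σ τ, ← map_mul, unlabel_push]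

/-- A relabelling-invariant bilinear operation on labelled graphs, as an operation on `Gra`. -/
def descend (B : ∀ n₁ n₂ : ℕ, LGra (Fin n₁) →ₗ[ℝ] LGra (Fin n₂) →ₗ[ℝ] Gra)
    (hB : ∀ n₁ n₂ (σ : Equiv.Perm (Fin n₁)) (τ : Equiv.Perm (Fin n₂)) x y,
      B n₁ n₂ (relabel _ σ x) (relabel _ τ y) = B n₁ n₂ x y) : Gra →ₗ[ℝ] Gra →ₗ[ℝ] Gra :=
  DirectSum.toModule ℝ ℕ _ fun n₁ => LinearMap.flip <| DirectSum.toModule ℝ ℕ _ fun n₂ =>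
    LinearMap.flip <| Representation.Coinvariants.lift _
      (LinearMap.flip <| Representation.Coinvariants.lift _ (B n₁ n₂).flip
        (fun τ => by
          refine LinearMap.ext fun y => LinearMap.ext fun x => ?_
          simpa using hB n₁ n₂ 1 τ x y))
      (fun σ => by
        refine LinearMap.ext fun x => LinearMap.ext fun y => ?_
        induction y using Representation.Coinvariants.induction_on with
        | _ y => simpa using hB n₁ n₂ σ 1 x y)

theorem descend_unlabel (B : ∀ n₁ n₂ : ℕ, LGra (Fin n₁) →ₗ[ℝ] LGra (Fin n₂) →ₗ[ℝ] Gra)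
    (hB : ∀ n₁ n₂ (σ : Equiv.Perm (Fin n₁)) (τ : Equiv.Perm (Fin n₂)) x y,
      B n₁ n₂ (relabel _ σ x) (relabel _ τ y) = B n₁ n₂ x y) {n₁ n₂ : ℕ}
    (x : LGra (Fin n₁)) (y : LGra (Fin n₂)) :
    descend B hB (unlabel _ x) (unlabel _ y) = B n₁ n₂ x y := by
  rw [unlabel_eq (Equiv.refl _) x, unlabel_eq (Equiv.refl _) y]
  simp only [descend, DirectSum.toModule_lof, LinearMap.flip_apply,
    Representation.Coinvariants.lift_mk]
  congr 1
  · exact congrArg _ (push_refl x)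
  · exact push_refl y

/-- The operadic insertion `x ∘ y` of `x` into the vertices of `y`, with the ordering
`E(x) ∧ E(y)` of edges. -/
def ins : Gra →ₗ[ℝ] Gra →ₗ[ℝ] Gra := descend insertLab insertLab_relabel

/-- The insertion of `x` into the vertices of `y`, with the ordering `E(y) ∧ E(x)` of edges. -/
def insRev : Gra →ₗ[ℝ] Gra →ₗ[ℝ] Gra := descend insertLab' insertLab'_relabel

/-- The super Lie bracket `[x, y] = x ∘ y - (-1)^(#E(x) #E(y)) y ∘ x`.  The sign is built in:
it is the one that brings `E(y) ∧ E(x)` to the order `E(x) ∧ E(y)`, see `bracket_eq`. -/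
def bracket : Gra →ₗ[ℝ] Gra →ₗ[ℝ] Gra := ins - insRev.flip

theorem bracket_apply (x y : Gra) : bracket x y = ins x y - insRev y x := rfl

theorem odd_prod_comm {A : Type*} [Ring A] (l l' : List A)
    (h : ∀ a ∈ l, ∀ b ∈ l', a * b = - (b * a)) :
    l.prod * l'.prod = (-1) ^ (l.length * l'.length) * (l'.prod * l.prod) := by
  have key : ∀ (a : A) (l' : List A), (∀ b ∈ l', a * b = - (b * a)) →
      a * l'.prod = (-1) ^ l'.length * (l'.prod * a) := by
    intro a l' h
    induction l' with
    | nil => simp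
    | cons b t ih =>
      have h1 := h b (by simp)
      have h2 := ih fun c hc => h c (by simp [hc])
      have hc : b * (-1) ^ t.length = (-1) ^ t.length * b :=
        ((Commute.neg_one_right b).pow_right _).eq
      calc a * (b :: t).prod = (a * b) * t.prod := by simp [mul_assoc]
        _ = - (b * (a * t.prod)) := by rw [h1]; simp [mul_assoc]
        _ = - ((b * (-1) ^ t.length) * (t.prod * a)) := by rw [h2]; simp [mul_assoc]
        _ = _ := by rw [hc]; simp [pow_succ, mul_assoc]
  induction l with
  | nil => simp
  | cons a t ih =>
    have h1 := key a l' (h a (by simp))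
    have h2 := ih fun c hc => h c (by simp [hc])
    have hc : a * (-1) ^ (t.length * l'.length) = (-1) ^ (t.length * l'.length) * a :=
      ((Commute.neg_one_right a).pow_right _).eq
    calc (a :: t).prod * l'.prod = a * (t.prod * l'.prod) := by simp [mul_assoc]
      _ = (a * (-1) ^ (t.length * l'.length)) * (l'.prod * t.prod) := by
        rw [h2]; simp [mul_assoc]
      _ = (-1) ^ (t.length * l'.length) * ((a * l'.prod) * t.prod) := by
        rw [hc]; simp [mul_assoc]
      _ = (-1) ^ (t.length * l'.length) * (-1) ^ l'.length * (l'.prod * (a :: t).prod) := by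
        rw [h1]; simp [mul_assoc]
      _ = _ := by rw [← pow_add]; congr 2; simp; ring

/-- On graphs with `p` and `q` edges the bracket is given by the usual formula. -/
theorem bracket_eq {n₁ n₂ p q : ℕ} {x y : Gra} (hx : x ∈ homogeneous n₁ p)
    (hy : y ∈ homogeneous n₂ q) :
    bracket x y = ins x y - (-1 : ℝ) ^ (p * q) • ins y x := by
  rw [bracket_apply]
  congr 1
  induction hx using Submodule.span_induction with
  | zero => simp
  | add a b _ _ ha hb => simp [ha, hb]
  | smul c a _ ha => simp [ha, smul_comm c]
  | mem a ha =>
    induction hy using Submodule.span_induction with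
    | zero => simp
    | add a b _ _ ha hb => simp [ha, hb]
    | smul c a _ ha => simp [ha, smul_comm c]
    | mem b hb =>
      obtain ⟨l, rfl, -, -, rfl⟩ := ha
      obtain ⟨l', rfl, -, -, rfl⟩ := hb
      simp only [graph, insRev, ins, descend_unlabel, insertLab_apply, insertLab'_apply,
        Finset.smul_sum, insertAt_apply, insertAt'_apply]
      refine Finset.sum_congr rfl fun v _ => ?_
      rw [← map_smul]
      congr 1
      have h := odd_prod_comm
        (l.map fun e => redirect (collapse (Fin n₂) v) (edgeGen e))
        (l'.map fun e => push (Function.Embedding.inl : _ ↪ Blow (Fin n₂) (Fin n₁) v)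
          (edgeGen e)) (by
          simp only [List.mem_map, forall_exists_index, and_imp]
          rintro _ e _ rfl _ e' _ rfl
          simp only [redirect, push, edgeGen, ExteriorAlgebra.map_apply_ι]
          exact eq_neg_of_add_eq_zero_left (ExteriorAlgebra.ι_add_mul_swap _ _))
      simp only [map_list_prod, List.map_map, List.length_map] at h ⊢
      have h3 : ((-1 : LGra (Blow (Fin n₂) (Fin n₁) v)) ^ (l.length * l'.length)) =
          algebraMap ℝ _ ((-1 : ℝ) ^ (l.length * l'.length)) := by simp
      rw [h3, ← Algebra.smul_def] at h
      exact h

/-- The graph with two vertices and the edge between them. -/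
def stick : Gra := graph 2 [⟨s(0, 1), by simp⟩]

/-- The cocycles: sums of connected graphs in bi-gradings `(n, 2n - 2)` that are annihilated by
the vertex-expanding differential `d = [stick, ·]`.  Here `n = k + 1 ≥ 1`. -/
def cocycles : Submodule ℝ Gra :=
  (⨆ k : ℕ, homogeneous (k + 1) (2 * k)) ⊓ LinearMap.ker (bracket stick)

theorem mem_cocycles {γ : Gra} : γ ∈ cocycles ↔
    γ ∈ (⨆ k : ℕ, homogeneous (k + 1) (2 * k)) ∧ bracket stick γ = 0 := by
  simp [cocycles]

/-! ## Multivectors as superfunctions -/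

/-- The algebra of smooth real functions on `E`. -/
def Smooth (E : Type) [NormedAddCommGroup E] [NormedSpace ℝ E] : Subalgebra ℝ (E → ℝ) where
  carrier := {f | ContDiff ℝ ∞ f}
  mul_mem' hf hg := ContDiff.mul (𝕜 := ℝ) (n := ∞) (Set.mem_ofPred.1 hf) (Set.mem_ofPred.1 hg)
  add_mem' hf hg := ContDiff.add (𝕜 := ℝ) (n := ∞) (Set.mem_ofPred.1 hf) (Set.mem_ofPred.1 hg)
  algebraMap_mem' c := Set.mem_ofPred.2 (contDiff_const (c := c))

theorem smooth_contDiff {E : Type} [NormedAddCommGroup E] [NormedSpace ℝ E] (f : Smooth E) :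
    ContDiff ℝ ∞ f.1 := f.2

section Super

variable {E F : Type} [NormedAddCommGroup E] [NormedSpace ℝ E] [NormedAddCommGroup F]
  [NormedSpace ℝ F]

/-- Multivector fields with smooth coefficients on the affine space `E` (finite-dimensional in
all uses), i.e. functions on the parity-odd cotangent bundle of `E`; the odd
fibre coordinates `ξ` are the constant vector fields. -/
abbrev Multi (E : Type) [NormedAddCommGroup E] [NormedSpace ℝ E] : Type :=
  Smooth E ⊗[ℝ] ExteriorAlgebra ℝ E

instance instRingMulti (E : Type) [NormedAddCommGroup E] [NormedSpace ℝ E] : Ring (Multi E) :=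
  Algebra.TensorProduct.instRing

instance instAddCommGroupMulti (E : Type) [NormedAddCommGroup E] [NormedSpace ℝ E] :
    AddCommGroup (Multi E) := Ring.toAddCommGroup

/-- Directional derivative of smooth functions. -/
def derivSmooth (v : E) : Smooth E →ₗ[ℝ] Smooth E where
  toFun f := ⟨fun x => fderiv ℝ f.1 x v,
    (ContDiff.fderiv_right (m := ∞) (smooth_contDiff f) (by simp)).clm_apply contDiff_const⟩
  map_add' f g := by
    apply Subtype.ext
    funext x
    have hf : DifferentiableAt ℝ f.1 x := ((smooth_contDiff f).differentiable (by simp)) x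
    have hg : DifferentiableAt ℝ g.1 x := ((smooth_contDiff g).differentiable (by simp)) x
    simp [fderiv_add hf hg]
  map_smul' c f := by
    apply Subtype.ext
    funext x
    have hf : DifferentiableAt ℝ f.1 x := ((smooth_contDiff f).differentiable (by simp)) x
    simp [fderiv_const_smul hf]

/-- The even derivation `∂/∂x` of superfunctions in the direction `v`. -/
def dX (v : E) : Module.End ℝ (Multi E) := (derivSmooth v).rTensor _

/-- The left odd derivation `∂/∂ξ` of superfunctions: contraction with the covector `φ`. -/
def dXi (φ : Module.Dual ℝ E) : Module.End ℝ (Multi E) :=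
  (CliffordAlgebra.contractLeft (Q := (0 : QuadraticForm ℝ E)) φ).lTensor _

/-- The right odd derivation of superfunctions. -/
def dXiRight (φ : Module.Dual ℝ E) : Module.End ℝ (Multi E) :=
  ((CliffordAlgebra.contractRight (Q := (0 : QuadraticForm ℝ E))).flip φ).lTensor _

/-- Composition of smooth functions with a linear map. -/
def pullback (L : E →L[ℝ] F) : Smooth F →ₐ[ℝ] Smooth E where
  toFun f := ⟨fun x => f.1 (L x), ContDiff.comp (smooth_contDiff f) L.contDiff⟩
  map_one' := rfl
  map_mul' _ _ := rfl
  map_zero' := rfl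
  map_add' _ _ := rfl
  commutes' _ := rfl

/-- The substitution of `L x` for the even variables and `M ξ` for the odd ones. -/
def subst (L : E →L[ℝ] F) (M : F →ₗ[ℝ] E) : Multi F →ₐ[ℝ] Multi E :=
  Algebra.TensorProduct.map (pullback L) (ExteriorAlgebra.map M)

theorem subst_subst {G : Type} [NormedAddCommGroup G] [NormedSpace ℝ G] (L : E →L[ℝ] F)
    (M : F →ₗ[ℝ] E) (L' : F →L[ℝ] G) (M' : G →ₗ[ℝ] F) (a : Multi G) :
    subst L M (subst L' M' a) = subst (L'.comp L) (M ∘ₗ M') a := by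
  induction a using TensorProduct.induction_on with
  | zero => simp
  | add a b ha hb => simp only [map_add, ha, hb]
  | tmul f w =>
    simp only [subst, Algebra.TensorProduct.map_tmul, ← ExteriorAlgebra.map_comp_map,
      AlgHom.comp_apply]
    rfl

theorem dX_subst (L : E →L[ℝ] F) (M : F →ₗ[ℝ] E) (v : E) (a : Multi F) :
    dX v (subst L M a) = subst L M (dX (L v) a) := by
  induction a using TensorProduct.induction_on with
  | zero => simp
  | add a b ha hb => simp only [map_add, ha, hb]
  | tmul f w =>
    simp only [subst, dX, Algebra.TensorProduct.map_tmul, LinearMap.rTensor_tmul]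
    congr 1
    apply Subtype.ext
    funext x
    have hf : DifferentiableAt ℝ f.1 (L x) := ((smooth_contDiff f).differentiable (by simp)) _
    have := fderiv_comp x hf L.differentiableAt
    change fderiv ℝ (f.1 ∘ L) x v = _
    rw [this]
    simp only [ContinuousLinearMap.fderiv, ContinuousLinearMap.comp_apply]
    rfl

theorem contractLeft_map (M : F →ₗ[ℝ] E) (φ : Module.Dual ℝ E) (w : ExteriorAlgebra ℝ F) :
    CliffordAlgebra.contractLeft (Q := (0 : QuadraticForm ℝ E)) φ (ExteriorAlgebra.map M w) =
      ExteriorAlgebra.map M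
        (CliffordAlgebra.contractLeft (Q := (0 : QuadraticForm ℝ F)) (φ ∘ₗ M) w) := by
  induction w using CliffordAlgebra.left_induction with
  | algebraMap r =>
    rw [CliffordAlgebra.contractLeft_algebraMap, map_zero]
    have : ExteriorAlgebra.map M (algebraMap ℝ (CliffordAlgebra (0 : QuadraticForm ℝ F)) r) =
      algebraMap ℝ _ r := AlgHom.commutes _ r
    rw [this, CliffordAlgebra.contractLeft_algebraMap]
  | add a b ha hb => simp only [map_add, ha, hb]
  | ι_mul a m ha =>
    rw [CliffordAlgebra.contractLeft_ι_mul]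
    have h1 : ExteriorAlgebra.map M (CliffordAlgebra.ι (0 : QuadraticForm ℝ F) m * a) =
        CliffordAlgebra.ι (0 : QuadraticForm ℝ E) (M m) * ExteriorAlgebra.map M a := by
      rw [map_mul]
      congr 1
      exact ExteriorAlgebra.map_apply_ι M m
    rw [h1, CliffordAlgebra.contractLeft_ι_mul, ha, map_sub, map_smul, map_mul]
    congr 2
    exact (ExteriorAlgebra.map_apply_ι M m).symm

theorem dXi_subst (L : E →L[ℝ] F) (M : F →ₗ[ℝ] E) (φ : Module.Dual ℝ E) (a : Multi F) :
    dXi φ (subst L M a) = subst L M (dXi (φ ∘ₗ M) a) := by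
  induction a using TensorProduct.induction_on with
  | zero => simp
  | add a b ha hb => simp only [map_add, ha, hb]
  | tmul f w =>
    simp only [subst, dXi, Algebra.TensorProduct.map_tmul, LinearMap.lTensor_tmul,
      contractLeft_map]

theorem dX_comm (v w : E) : dX v * dX w = dX w * dX v := by
  apply TensorProduct.ext'
  intro f a
  simp only [dX, Module.End.mul_apply, LinearMap.rTensor_tmul]
  congr 1
  apply Subtype.ext
  funext x
  have hd : DifferentiableAt ℝ (fderiv ℝ f.1) x :=
    (ContDiff.fderiv_right (m := ∞) (smooth_contDiff f) (by simp)).differentiable (by simp) x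
  have key : ∀ v w : E, fderiv ℝ (fun y => fderiv ℝ f.1 y w) x v =
      fderiv ℝ (fderiv ℝ f.1) x v w := by
    intro v w
    rw [fderiv_clm_apply hd (differentiableAt_const w)]
    simp
  change fderiv ℝ (fun y => fderiv ℝ f.1 y w) x v = fderiv ℝ (fun y => fderiv ℝ f.1 y v) x w
  rw [key, key]
  have hs : IsSymmSndFDerivAt ℝ f.1 x :=
    ((smooth_contDiff f).contDiffAt).isSymmSndFDerivAt (by
      simp only [minSmoothness_of_isRCLikeNormedField]
      exact WithTop.coe_le_coe.2 le_top)
  exact hs v w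

theorem dX_dXi (v : E) (φ : Module.Dual ℝ E) : dX v * dXi φ = dXi φ * dX v := by
  apply TensorProduct.ext'
  intro f a
  simp [dX, dXi]

theorem dXi_anticomm (φ ψ : Module.Dual ℝ E) : dXi φ * dXi ψ + dXi ψ * dXi φ = 0 := by
  apply TensorProduct.ext'
  intro f a
  simp only [dXi, LinearMap.add_apply, Module.End.mul_apply, LinearMap.lTensor_tmul,
    LinearMap.zero_apply]
  rw [CliffordAlgebra.contractLeft_comm, ← TensorProduct.tmul_add, neg_add_cancel,
    TensorProduct.tmul_zero]

/-- The bi-vectors. -/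
def bivectors (E : Type) [NormedAddCommGroup E] [NormedSpace ℝ E] : Submodule ℝ (Multi E) :=
  LinearMap.range ((⋀[ℝ]^2 E).subtype.lTensor (Smooth E))

/-- The real number `φ (F(x))`, where `F(x)` is the value at the point `x` of a multivector
field and `φ` is a linear functional on constant multivectors. -/
def component (x : E) (φ : Module.Dual ℝ (ExteriorAlgebra ℝ E)) : Multi E →ₗ[ℝ] ℝ :=
  TensorProduct.lift ((LinearMap.mul ℝ ℝ).compl₁₂
    ((LinearMap.proj x : (E → ℝ) →ₗ[ℝ] ℝ) ∘ₗ (Smooth E).val.toLinearMap) φ)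

/-- `W` is the derivative at `P` of the map `Q` between multivector fields, in the direction of
`V`: the velocity of `ε ↦ Q (P + ε V)` at `ε = 0`, at every point and for every component. -/
def HasVelocity (Q : Multi E → Multi E) (P V W : Multi E) : Prop :=
  ∀ (x : E) (φ : Module.Dual ℝ (ExteriorAlgebra ℝ E)),
    HasDerivAt (fun ε : ℝ => component x φ (Q (P + ε • V))) (component x φ W) 0

/-- `C` is the value at `P` of the commutator `[d/dε₁, d/dε₂]` of the two flows
`d/dεᵢ (P) = Qᵢ(P)`, that is, `C = d/dε₁ (Q₂(P)) - d/dε₂ (Q₁(P))`, where `d/dεᵢ` differentiates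
along `Qᵢ(P)` (both derivatives are required to exist). -/
def IsFlowCommutator (Q₁ Q₂ : Multi E → Multi E) (P C : Multi E) : Prop :=
  ∃ W₁₂ W₂₁ : Multi E, HasVelocity Q₂ P (Q₁ P) W₁₂ ∧ HasVelocity Q₁ P (Q₂ P) W₂₁ ∧
    C = W₁₂ - W₂₁

end Super

/-- The affine space `ℝᵈ` (only its smooth structure and linear structure are used). -/
abbrev Pt (d : ℕ) : Type := Fin d → ℝ

/-- The Schouten bracket
`⟦F, G⟧ = ∑ (F)∂⃖/∂ξ_α · ∂⃗/∂x^α(G) - (F)∂⃖/∂x^α · ∂⃗/∂ξ_α(G)`. -/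
def schouten {d : ℕ} (F G : Multi (Pt d)) : Multi (Pt d) :=
  ∑ α : Fin d, (dXiRight (LinearMap.proj α) F * dX (Pi.single α 1) G -
    dX (Pi.single α 1) F * dXi (LinearMap.proj α) G)

/-- Poisson bi-vectors. -/
def IsPoisson {d : ℕ} (P : Multi (Pt d)) : Prop := P ∈ bivectors (Pt d) ∧ schouten P P = 0

/-! ## The orientation morphism -/

section Orient

variable {V : Type} [Fintype V] [DecidableEq V] {d : ℕ}

/-- `∂/∂x^α` acting on the copy of multivectors in the vertex `i`. -/
def dXAt (i : V) (α : Fin d) : Module.End ℝ (Multi (V → Pt d)) :=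
  dX (Pi.single i (Pi.single α 1))

/-- `∂/∂ξ_α` acting on the copy of multivectors in the vertex `i`. -/
def dXiAt (i : V) (α : Fin d) : Module.End ℝ (Multi (V → Pt d)) :=
  dXi (LinearMap.proj (R := ℝ) (φ := fun _ : Fin d => ℝ) α ∘ₗ
    LinearMap.proj (R := ℝ) (φ := fun _ : V => Pt d) i)

/-- The edge operator `Δ_ij = ∑ ∂/∂ξ_α^(i) ⊗ ∂/∂x^α_(j) + ∂/∂x^α_(i) ⊗ ∂/∂ξ_α^(j)`. -/
def edgeOp (d : ℕ) : Sym2 V → Module.End ℝ (Multi (V → Pt d)) :=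
  Sym2.lift ⟨fun i j => ∑ α : Fin d, (dXiAt i α * dXAt j α + dXAt i α * dXiAt j α),
    fun i j => Finset.sum_congr rfl fun α _ => by
      simp only [dXiAt, dXAt, dX_dXi]
      exact add_comm _ _⟩

theorem edgeOp_anticomm (e e' : Sym2 V) :
    edgeOp d e * edgeOp d e' + edgeOp d e' * edgeOp d e = 0 := by
  induction e with | _ i j
  induction e' with | _ k l
  have key : ∀ (i j k l : V) (α β : Fin d),
      (dXiAt i α * dXAt j α) * (dXiAt k β * dXAt l β) +
        (dXiAt k β * dXAt l β) * (dXiAt i α * dXAt j α) = 0 := by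
    intro i j k l α β
    simp only [dXiAt, dXAt]
    generalize (LinearMap.proj (R := ℝ) (φ := fun _ : Fin d => ℝ) α ∘ₗ
      LinearMap.proj (R := ℝ) (φ := fun _ : V => Pt d) i) = φ
    generalize (LinearMap.proj (R := ℝ) (φ := fun _ : Fin d => ℝ) β ∘ₗ
      LinearMap.proj (R := ℝ) (φ := fun _ : V => Pt d) k) = ψ
    generalize (Pi.single j (Pi.single α 1) : V → Pt d) = v
    generalize (Pi.single l (Pi.single β 1) : V → Pt d) = w
    have h1 : (dXi φ * dX v) * (dXi ψ * dX w) = (dXi φ * dXi ψ) * (dX v * dX w) := by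
      rw [mul_assoc, ← mul_assoc (dX v), dX_dXi, mul_assoc, mul_assoc]
    have h2 : (dXi ψ * dX w) * (dXi φ * dX v) = (dXi ψ * dXi φ) * (dX w * dX v) := by
      rw [mul_assoc, ← mul_assoc (dX w), dX_dXi, mul_assoc, mul_assoc]
    rw [h1, h2, dX_comm v w, ← add_mul, dXi_anticomm, zero_mul]
  have hsymm : ∀ (i j : V) (α : Fin d), (dXAt i α * dXiAt j α) = dXiAt j α * dXAt i α :=
    fun i j α => dX_dXi _ _
  simp only [edgeOp, Sym2.lift_mk, hsymm, Finset.sum_mul_sum]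
  rw [Finset.sum_comm (γ := Fin d) (s := Finset.univ (α := Fin d)), ← Finset.sum_add_distrib]
  refine Finset.sum_eq_zero fun β _ => ?_
  rw [← Finset.sum_add_distrib]
  refine Finset.sum_eq_zero fun α _ => ?_
  have h1 := key i j k l α β
  have h2 := key i j l k α β
  have h3 := key j i k l α β
  have h4 := key j i l k α β
  simp only [add_mul, mul_add]
  calc _ = (dXiAt i α * dXAt j α * (dXiAt k β * dXAt l β) +
          dXiAt k β * dXAt l β * (dXiAt i α * dXAt j α)) +
        (dXiAt i α * dXAt j α * (dXiAt l β * dXAt k β) +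
          dXiAt l β * dXAt k β * (dXiAt i α * dXAt j α)) +
        (dXiAt j α * dXAt i α * (dXiAt k β * dXAt l β) +
          dXiAt k β * dXAt l β * (dXiAt j α * dXAt i α)) +
        (dXiAt j α * dXAt i α * (dXiAt l β * dXAt k β) +
          dXiAt l β * dXAt k β * (dXiAt j α * dXAt i α)) := by abel
    _ = 0 := by rw [h1, h2, h3, h4]; simp

/-- The operator of the linear combination of edges. -/
def edgeOpLin (V : Type) [Fintype V] [DecidableEq V] (d : ℕ) :
    (Edge V →₀ ℝ) →ₗ[ℝ] Module.End ℝ (Multi (V → Pt d)) :=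
  Finsupp.linearCombination ℝ fun e : Edge V => edgeOp d e.1

theorem edgeOpLin_sq (a : Edge V →₀ ℝ) : edgeOpLin V d a * edgeOpLin V d a = 0 := by
  have h : ∀ a b : Edge V →₀ ℝ,
      edgeOpLin V d a * edgeOpLin V d b + edgeOpLin V d b * edgeOpLin V d a = 0 := by
    intro a b
    induction a using Finsupp.induction_linear with
    | zero => simp
    | add x y hx hy =>
      have := congrArg₂ (· + ·) hx hy
      simp only [map_add, add_mul, mul_add] at this ⊢
      rw [add_add_add_comm, this, add_zero]
    | single e c =>
      induction b using Finsupp.induction_linear with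
      | zero => simp
      | add x y hx hy =>
        have := congrArg₂ (· + ·) hx hy
        simp only [map_add, add_mul, mul_add] at this ⊢
        rw [add_add_add_comm, this, add_zero]
      | single e' c' =>
        simp only [edgeOpLin, Finsupp.linearCombination_single, smul_mul_smul_comm]
        rw [mul_comm c' c, ← smul_add, edgeOp_anticomm, smul_zero]
  have h2 := h a a
  rw [← two_smul ℝ] at h2
  exact (smul_eq_zero.1 h2).resolve_left two_ne_zero

/-- The ordered product of edge operators: in the operator of `I ∧ II ∧ …` the first edge `I`
acts first and the last edge acts last (whence the opposite algebra). -/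
def graphOp (V : Type) [Fintype V] [DecidableEq V] (d : ℕ) :
    LGra V →ₐ[ℝ] (Module.End ℝ (Multi (V → Pt d)))ᵐᵒᵖ :=
  ExteriorAlgebra.lift ℝ ⟨(MulOpposite.opLinearEquiv ℝ).toLinearMap ∘ₗ edgeOpLin V d, fun a => by
    simp only [LinearMap.comp_apply, LinearEquiv.coe_coe, MulOpposite.coe_opLinearEquiv,
      ← MulOpposite.op_mul, edgeOpLin_sq, MulOpposite.op_zero]⟩

/-- The multivector `℘` placed in the vertex `v`. -/
def place (v : V) : Multi (Pt d) →ₐ[ℝ] Multi (V → Pt d) :=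
  subst (ContinuousLinearMap.proj v) (LinearMap.single ℝ (fun _ : V => Pt d) v)

/-- Restriction to the diagonal: the copies of the variables in all the vertices are identified. -/
def diagonal (V : Type) [Fintype V] [DecidableEq V] (d : ℕ) :
    Multi (V → Pt d) →ₐ[ℝ] Multi (Pt d) :=
  subst (ContinuousLinearMap.pi fun _ : V => ContinuousLinearMap.id ℝ (Pt d))
    (∑ v : V, LinearMap.proj (R := ℝ) (φ := fun _ : V => Pt d) v)

/-- Permutation of the copies of the variables. -/
def permute (τ : Equiv.Perm V) : Multi (V → Pt d) →ₐ[ℝ] Multi (V → Pt d) :=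
  subst (ContinuousLinearMap.pi fun v => ContinuousLinearMap.proj (τ v))
    (LinearMap.funLeft ℝ (Pt d) τ.symm)

theorem permute_place (τ : Equiv.Perm V) (v : V) (a : Multi (Pt d)) :
    permute τ (place v a) = place (τ v) a := by
  simp only [permute, place, subst_subst]
  congr 2
  ext α w β
  by_cases h : w = τ v
  · subst h
    simp [LinearMap.funLeft]
  · have h' : τ.symm w ≠ v := fun h' => h (by simp [← h'])
    simp [LinearMap.funLeft, h, h']

theorem diagonal_permute (τ : Equiv.Perm V) (a : Multi (V → Pt d)) :
    diagonal V d (permute τ a) = diagonal V d a := by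
  simp only [permute, diagonal, subst_subst]
  congr 2
  apply LinearMap.ext
  intro f
  simp only [LinearMap.comp_apply, LinearMap.sum_apply, LinearMap.proj_apply, LinearMap.funLeft]
  exact Equiv.sum_comp τ.symm f

theorem dXAt_permute (τ : Equiv.Perm V) (i : V) (α : Fin d) (a : Multi (V → Pt d)) :
    dXAt (τ i) α (permute τ a) = permute τ (dXAt i α a) := by
  simp only [dXAt, permute, dX_subst]
  congr 3
  ext w β
  by_cases h : w = i
  · subst h
    simp
  · simp [h]

theorem dXiAt_permute {V : Type} [Fintype V] (τ : Equiv.Perm V) (i : V) (α : Fin d) (a : Multi (V → Pt d)) :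
    dXiAt (τ i) α (permute τ a) = permute τ (dXiAt i α a) := by
  simp only [dXiAt, permute, dXi_subst]
  congr 3
  apply LinearMap.ext
  intro f
  simp [LinearMap.funLeft]

theorem edgeOp_permute (τ : Equiv.Perm V) (e : Sym2 V) (a : Multi (V → Pt d)) :
    edgeOp d (e.map τ) (permute τ a) = permute τ (edgeOp d e a) := by
  induction e with | _ i j
  simp only [edgeOp, Sym2.map_mk, Sym2.lift_mk, LinearMap.sum_apply, LinearMap.add_apply,
    Module.End.mul_apply, map_sum, map_add, dXAt_permute, dXiAt_permute]

theorem graphOp_push (τ : Equiv.Perm V) (x : LGra V) (a : Multi (V → Pt d)) :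
    (graphOp V d (push τ.toEmbedding x)).unop (permute τ a) =
      permute τ ((graphOp V d x).unop a) := by
  induction x using ExteriorAlgebra.induction generalizing a with
  | algebraMap r =>
    simp only [AlgHom.commutes, MulOpposite.algebraMap_apply, MulOpposite.unop_op,
      Module.algebraMap_end_apply, map_smul]
  | ι m =>
    induction m using Finsupp.induction_linear with
    | zero => simp
    | add x y hx hy =>
      simp only [map_add, MulOpposite.unop_add, LinearMap.add_apply, hx, hy]
    | single e c =>
      have h : ∀ (e : Edge V) (b : Multi (V → Pt d)),
          (graphOp V d (ExteriorAlgebra.ι ℝ (Finsupp.single e c))).unop b =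
            c • edgeOp d e.1 b := by
        intro e b
        simp [graphOp, edgeOpLin, ExteriorAlgebra.lift_ι_apply]
      have h' : push τ.toEmbedding (ExteriorAlgebra.ι ℝ (Finsupp.single e c)) =
          ExteriorAlgebra.ι ℝ (Finsupp.single (e.map τ.toEmbedding) c) := by
        simp [push, ExteriorAlgebra.map_apply_ι]
      rw [h', h, h, map_smul, ← edgeOp_permute]
      rfl
  | mul x y hx hy =>
    simp only [map_mul, MulOpposite.unop_mul, Module.End.mul_apply, hx, hy]
  | add x y hx hy =>
    simp only [map_add, MulOpposite.unop_add, LinearMap.add_apply, hx, hy]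

/-- The sum over `σ ∈ S_n` in the orientation formula, for labelled graphs: the `i`-th multivector
is placed into the vertex `σ(i)`, and the ordered product of the edge operators is applied. -/
def orientLab (n d : ℕ) (p : Fin n → Multi (Pt d)) : LGra (Fin n) →ₗ[ℝ] Multi (Pt d) :=
  ((n.factorial : ℝ)⁻¹) • ∑ σ : Equiv.Perm (Fin n),
    (diagonal (Fin n) d).toLinearMap ∘ₗ
      LinearMap.applyₗ (List.ofFn fun i => place (σ i) (p i)).prod ∘ₗ
        (MulOpposite.opLinearEquiv ℝ).symm.toLinearMap ∘ₗ (graphOp (Fin n) d).toLinearMap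

theorem orientLab_apply (n d : ℕ) (p : Fin n → Multi (Pt d)) (x : LGra (Fin n)) :
    orientLab n d p x = ((n.factorial : ℝ)⁻¹) • ∑ σ : Equiv.Perm (Fin n),
      diagonal (Fin n) d ((graphOp (Fin n) d x).unop
        (List.ofFn fun i => place (σ i) (p i)).prod) := by
  simp [orientLab, LinearMap.sum_apply]

theorem orientLab_relabel (n d : ℕ) (p : Fin n → Multi (Pt d)) (τ : Equiv.Perm (Fin n)) :
    orientLab n d p ∘ₗ relabel (Fin n) τ = orientLab n d p := by
  refine LinearMap.ext fun x => ?_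
  rw [LinearMap.comp_apply, orientLab_apply, orientLab_apply, relabel_apply,
    ← Equiv.sum_comp (Equiv.mulLeft τ)]
  congr 1
  refine Finset.sum_congr rfl fun σ _ => ?_
  have h : (List.ofFn fun i => place (V := Fin n) ((Equiv.mulLeft τ σ) i) (p i)).prod =
      permute τ (List.ofFn fun i => place (V := Fin n) (σ i) (p i)).prod := by
    rw [map_list_prod, List.map_ofFn]
    congr 2
    funext i
    simp [permute_place]
  rw [h, graphOp_push, diagonal_permute]

/-- The orientation morphism evaluated at `n` multivectors,
`Or(γ)(℘₁ ⊗ … ⊗ ℘ₙ) = 1/n! ∑_σ ∏_e Δ_e (℘₁|_{σ(1)} ⋯ ℘ₙ|_{σ(n)})`. -/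
def orient (n d : ℕ) (p : Fin n → Multi (Pt d)) : UGra n →ₗ[ℝ] Multi (Pt d) :=
  Representation.Coinvariants.lift _ (orientLab n d p) (orientLab_relabel n d p)

/-- `Or(γ)(P)`: copies of the same multivector `P` are placed in all the vertices. -/
def OrMap {d : ℕ} (P : Multi (Pt d)) : Gra →ₗ[ℝ] Multi (Pt d) :=
  DirectSum.toModule ℝ ℕ _ fun n => orient n d fun _ => P

end Orient

end GraphOr

end

/-! A graph in bi-grading $(n,2n-2)$ has an even number of edges, so its wedge monomial is central
and the signs in the bracket disappear: on even graphs the bracket is the plain commutator of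
insertion. The associator $a\circ(b\circ c)-(a\circ b)\circ c$ is the sum of insertions of $a$ and
$b$ into two distinct vertices of $c$, which is symmetric in $a$ and $b$ when $a$ is even
(`ins_preLie`). This pre-Lie identity gives Jacobi (`bracket_jacobi`) with no parity assumption on
one argument. Taking that argument to be the stick shows that $\mathrm d$ is a derivation, so its
kernel is closed under the bracket.

On the side of multivectors, a bi-vector $P$ is an even superfunction and even superfunctions
commute; hence all $n!$ placements of copies of $P$ agree. By the chain rule, a derivative taken
after identifying variables is the sum of the derivatives over the identified copies, and this is
exactly the redirection of edges. As the edges of the inserted graph act first,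
$\mathrm{Or}(\gamma_1\circ\gamma_2)(P)$ is the sum over the vertices $v$ of $\gamma_2$ of its value
with $\mathrm{Or}(\gamma_1)(P)$ in $v$ and $P$ elsewhere (`evalGraph_insertAt`,
`OrMap_ins_unlabel`).

Two consequences finish the proof. Since $\mathrm{Or}(\gamma_2)(P)$ is polynomial in $P$, that sum
is the velocity of $Q_2$ along $Q_1(P)$ (`hasVelocity_OrMap`), so the bracket goes to the commutator
of flows. Moreover $\mathrm{Or}(\bullet\!\!-\!\!\bullet)(P)=-[\![P,P]\!]=0$ annihilates every
$\bullet\!\!-\!\!\bullet\circ\gamma$, whereas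
$\mathrm{Or}(\gamma\circ\bullet\!\!-\!\!\bullet)(P)=-2[\![P,\mathrm{Or}(\gamma)(P)]\!]$
(`OrMap_ins_stick`); thus $\mathrm d\gamma=0$ forces $[\![P,\mathrm{Or}(\gamma)(P)]\!]=0$. -/

noncomputable section

set_option linter.unusedSectionVars false

namespace GraphOr

/-! ## The even part of an exterior algebra -/

section Even

variable {M N : Type*} [AddCommGroup M] [Module ℝ M] [AddCommGroup N] [Module ℝ N]

/-- The even subalgebra of the exterior algebra, generated by the products of two vectors. -/
def evenAlg (M : Type*) [AddCommGroup M] [Module ℝ M] : Subalgebra ℝ (ExteriorAlgebra ℝ M) :=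
  Algebra.adjoin ℝ {z | ∃ a b : M, z = ExteriorAlgebra.ι ℝ a * ExteriorAlgebra.ι ℝ b}

theorem ι_mul_ι_mem_evenAlg (a b : M) :
    ExteriorAlgebra.ι ℝ a * ExteriorAlgebra.ι ℝ b ∈ evenAlg M :=
  Algebra.subset_adjoin ⟨a, b, rfl⟩

theorem ι_mul_ι_swap (a b : M) : ExteriorAlgebra.ι ℝ a * ExteriorAlgebra.ι ℝ b =
    -(ExteriorAlgebra.ι ℝ b * ExteriorAlgebra.ι ℝ a) :=
  eq_neg_of_add_eq_zero_left (ExteriorAlgebra.ι_add_mul_swap _ _)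

theorem evenAlg_le_center : evenAlg M ≤ Subalgebra.center ℝ (ExteriorAlgebra ℝ M) := by
  refine Algebra.adjoin_le ?_
  rintro _ ⟨a, b, rfl⟩
  refine Subalgebra.mem_center_iff.2 fun y => ?_
  induction y using ExteriorAlgebra.induction with
  | algebraMap r => exact Algebra.commutes r _
  | ι c =>
    rw [← mul_assoc, ι_mul_ι_swap c a, neg_mul, mul_assoc, ι_mul_ι_swap c b, mul_neg, neg_neg,
      mul_assoc]
  | mul x y hx hy => rw [mul_assoc, hy, ← mul_assoc, hx, mul_assoc]
  | add x y hx hy => rw [add_mul, hx, hy, mul_add]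

theorem evenAlg_comm {x : ExteriorAlgebra ℝ M} (hx : x ∈ evenAlg M) (y : ExteriorAlgebra ℝ M) :
    x * y = y * x :=
  (Subalgebra.mem_center_iff.1 (evenAlg_le_center hx) y).symm

theorem map_mem_evenAlg (f : M →ₗ[ℝ] N) {x : ExteriorAlgebra ℝ M} (hx : x ∈ evenAlg M) :
    ExteriorAlgebra.map f x ∈ evenAlg N := by
  have : evenAlg M ≤ (evenAlg N).comap (ExteriorAlgebra.map f) := by
    refine Algebra.adjoin_le ?_
    rintro _ ⟨a, b, rfl⟩
    simpa [ExteriorAlgebra.map_apply_ι] using ι_mul_ι_mem_evenAlg (f a) (f b)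
  exact this hx

theorem list_prod_mem_evenAlg : ∀ l : List M, Even l.length →
    (l.map (ExteriorAlgebra.ι ℝ)).prod ∈ evenAlg M
  | [], _ => by simp
  | [a], h => by simp at h
  | a :: b :: l, h => by
    have := list_prod_mem_evenAlg l (by simpa [Nat.even_add_one] using h)
    simpa [← mul_assoc] using mul_mem (ι_mul_ι_mem_evenAlg a b) this

end Even

/-! ## Functoriality of redirection -/

theorem push_mem_evenAlg {V W : Type} (f : V ↪ W) {x : LGra V} (hx : x ∈ evenAlg (Edge V →₀ ℝ)) :
    push f x ∈ evenAlg (Edge W →₀ ℝ) := map_mem_evenAlg _ hx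

theorem redirect_mem_evenAlg {V W : Type} [Fintype W] (π : W → V) {x : LGra V}
    (hx : x ∈ evenAlg (Edge V →₀ ℝ)) : redirect π x ∈ evenAlg (Edge W →₀ ℝ) :=
  map_mem_evenAlg _ hx

/-- The edges over `e` along the composite map are grouped by their image in the middle vertex set,
and each has exactly one such image. -/
theorem redirect_redirect {U V W : Type} [Fintype V] [Fintype W] (π : V → U) (π' : W → V)
    (y : LGra U) : redirect π' (redirect π y) = redirect (π ∘ π') y := by
  classical
  have : (redirect π').comp (redirect π) = redirect (π ∘ π') := by
    apply lgra_hom_ext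
    intro e
    simp only [AlgHom.comp_apply, redirect_edgeGen, map_sum]
    rw [Finset.sum_comm' (t' := Finset.univ.filter fun e'' : Edge W => e''.1.map (π ∘ π') = e.1)
      (s' := fun e'' : Edge W => Finset.univ.filter fun e' : Edge V => e''.1.map π' = e'.1)]
    · refine Finset.sum_congr rfl fun e'' he'' => ?_
      have he'' := (Finset.mem_filter.1 he'').2
      rw [← Sym2.map_map] at he''
      -- The middle image is a genuine edge: a loop there would map to a loop, but `e` is not one.
      have hd : ¬ (e''.1.map π').IsDiag := fun h => e.2 (by
        rw [← he'']
        exact h.map)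
      have : (Finset.univ.filter fun e' : Edge V => e''.1.map π' = e'.1) = {⟨_, hd⟩} := by
        ext e'
        simp only [Finset.mem_filter, Finset.mem_univ, true_and, Finset.mem_singleton]
        exact ⟨fun h => Subtype.ext h.symm, fun h => by rw [h]⟩
      rw [this, Finset.sum_singleton]
    · intro e' e''
      simp only [Finset.mem_filter, Finset.mem_univ, true_and, ← Sym2.map_map]
      constructor
      · rintro ⟨h1, h2⟩
        exact ⟨h2, by rw [h2, h1]⟩
      · rintro ⟨h1, h2⟩
        exact ⟨by rw [← h2, h1], h1⟩
  exact DFunLike.congr_fun this y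

/-- Base change: by `hp`, every vertex that `π'` sends into the image of `f` comes from `g`, so
every lift of an edge of the subgraph lies inside the image of `g`. -/
theorem redirect_push_of_pullback {V V' W W' : Type} [Fintype W] [Fintype W'] (π : W → V)
    (π' : W' → V') (f : V ↪ V') (g : W ↪ W') (h : ∀ w, π' (g w) = f (π w))
    (hp : ∀ w' v, π' w' = f v → ∃ w, g w = w') (y : LGra V) :
    redirect π' (push f y) = push g (redirect π y) := by
  classical
  have : (redirect π').comp (push f) = (push g).comp (redirect π) := by
    apply lgra_hom_ext
    intro e
    simp only [AlgHom.comp_apply, push_edgeGen, redirect_edgeGen, map_sum]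
    symm
    refine Finset.sum_bij (fun a _ => a.map g) ?_ ?_ ?_ ?_
    · intro a ha
      refine Finset.mem_filter.2 ⟨Finset.mem_univ _, ?_⟩
      rw [Edge.map_val, Edge.map_val, ← (Finset.mem_filter.1 ha).2, Sym2.map_map, Sym2.map_map]
      congr 1
      ext w
      exact h w
    · intro a _ b _ hab
      apply Subtype.ext
      exact Sym2.map.injective g.injective (congrArg Subtype.val hab)
    · rintro ⟨b, hbd⟩ hb
      have hb := (Finset.mem_filter.1 hb).2
      rw [Edge.map_val] at hb
      have hlift : ∀ w' ∈ b, ∃ w, g w = w' := by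
        intro w' hw'
        have : π' w' ∈ e.1.map f := hb ▸ Sym2.mem_map.2 ⟨w', hw', rfl⟩
        obtain ⟨v, _, hv⟩ := Sym2.mem_map.1 this
        exact hp w' v hv.symm
      induction b with | _ p q
      obtain ⟨p, rfl⟩ := hlift p (by simp)
      obtain ⟨q, rfl⟩ := hlift q (by simp)
      refine ⟨⟨s(p, q), fun hd => hbd ?_⟩, ?_, ?_⟩
      · simp only [Sym2.mk_isDiag_iff] at hd ⊢
        rw [hd]
      · refine Finset.mem_filter.2 ⟨Finset.mem_univ _, ?_⟩
        apply Sym2.map.injective f.injective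
        rw [← hb]
        simp [h]
      · rfl
    · intro a _
      rfl
  exact DFunLike.congr_fun this y

theorem redirect_id {V : Type} [Fintype V] (y : LGra V) : redirect id y = y := by
  classical
  have : redirect (id : V → V) = AlgHom.id ℝ _ := by
    apply lgra_hom_ext
    intro e
    rw [redirect_edgeGen, AlgHom.id_apply]
    have : (Finset.univ.filter fun e' : Edge V => e'.1.map id = e.1) = {e} := by
      ext e'
      simp [Subtype.ext_iff]
    rw [this, Finset.sum_singleton]
  exact DFunLike.congr_fun this y

/-- If nothing of the graph is blown up then redirection is a transport of graphs. -/
theorem redirect_push_section {V V' W' : Type} [Fintype V] [Fintype W'] (π' : W' → V')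
    (f : V ↪ V') (g : V ↪ W') (h : ∀ w, π' (g w) = f w)
    (hp : ∀ w' v, π' w' = f v → ∃ w, g w = w') (y : LGra V) :
    redirect π' (push f y) = push g y := by
  rw [redirect_push_of_pullback id π' f g h hp, redirect_id]

/-! ## Insertion of graphs with arbitrary vertex sets -/

@[elab_as_elim]
theorem gra_induction {motive : Gra → Prop} (γ : Gra) (zero : motive 0)
    (unlabel : ∀ n (x : LGra (Fin n)), motive (unlabel (Fin n) x))
    (add : ∀ a b, motive a → motive b → motive (a + b)) : motive γ := by
  induction γ using DirectSum.induction_on with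
  | zero => exact zero
  | add a b ha hb => exact add a b ha hb
  | of n u =>
    induction u using Representation.Coinvariants.induction_on with
    | _ x =>
      have h := unlabel n x
      rw [unlabel_eq (Equiv.refl _) x] at h
      have h' : push (Equiv.refl (Fin n)).toEmbedding x = x := push_refl x
      rw [h'] at h
      exact h

/-- The bijection of the blown-up vertex sets induced by bijections of vertices. -/
def blowCongr {V₁ V₁' V₂ V₂' : Type} (σ : V₁ ≃ V₁') (τ : V₂ ≃ V₂') (v : V₂) :
    Blow V₁ V₂ v ≃ Blow V₁' V₂' (τ v) :=
  Equiv.sumCongr σ (τ.subtypeEquiv fun a => by simp)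

theorem push_inl_blowCongr {V₁ V₁' V₂ V₂' : Type} (σ : V₁ ≃ V₁') (τ : V₂ ≃ V₂') (v : V₂)
    (x : LGra V₁) :
    push (Function.Embedding.inl : V₁' ↪ Blow V₁' V₂' (τ v)) (push σ.toEmbedding x) =
      push (blowCongr σ τ v).toEmbedding (push Function.Embedding.inl x) := by
  rw [push_push, push_push]
  rfl

theorem redirect_blowCongr {V₁ V₁' V₂ V₂' : Type} [Fintype V₁] [Fintype V₂] [DecidableEq V₂]
    [Fintype V₁'] [Fintype V₂'] [DecidableEq V₂']
    (σ : V₁ ≃ V₁') (τ : V₂ ≃ V₂') (v : V₂) (y : LGra V₂) :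
    redirect (collapse V₁' (τ v)) (push τ.toEmbedding y) =
      push (blowCongr σ τ v).toEmbedding (redirect (collapse V₁ v) y) := by
  apply redirect_push
  rintro (w | w)
  · rfl
  · rfl

/-- `ins` is defined through vertex sets `Fin n`; iterated insertions live on nested `Blow` sets, so
the formula is needed for arbitrary finite vertex sets. -/
theorem ins_unlabel {V₁ V₂ : Type} [Fintype V₁] [Fintype V₂] [DecidableEq V₂] (x : LGra V₁)
    (y : LGra V₂) :
    ins (unlabel V₁ x) (unlabel V₂ y) = ∑ v, unlabel _ (insertAt v x y) := by
  rw [← unlabel_push (Fintype.equivFin V₁), ← unlabel_push (Fintype.equivFin V₂), ins,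
    descend_unlabel, insertLab_apply, ← Equiv.sum_comp (Fintype.equivFin V₂)]
  refine Finset.sum_congr rfl fun v _ => ?_
  rw [insertAt_apply, insertAt_apply, push_inl_blowCongr _ (Fintype.equivFin V₂),
    redirect_blowCongr (Fintype.equivFin V₁), ← map_mul, unlabel_push]

/-! ### The pre-Lie identity for insertion. -/

section PreLie

variable {V₁ V₂ V₃ : Type} [Fintype V₁] [Fintype V₂] [Fintype V₃]
  [DecidableEq V₂] [DecidableEq V₃]

/-- Insertion into a vertex of an inserted graph: the two ways to nest the vertex sets. -/
def blowNested (V₁ : Type) {V₂ V₃ : Type} (v : V₂) (w : V₃) :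
    Blow (Blow V₁ V₂ v) V₃ w ≃ Blow V₁ (Blow V₂ V₃ w) (Sum.inl v) where
  toFun
    | .inl (.inl a) => .inl a
    | .inl (.inr b) => .inr ⟨.inl b.1, fun h => b.2 (Sum.inl_injective h)⟩
    | .inr c => .inr ⟨.inr c, Sum.inr_ne_inl⟩
  invFun
    | .inl a => .inl (.inl a)
    | .inr ⟨.inl b, h⟩ => .inl (.inr ⟨b, fun h' => h (congrArg _ h')⟩)
    | .inr ⟨.inr c, _⟩ => .inr c
  left_inv := by rintro ((a | b) | c) <;> rfl
  right_inv := by rintro (a | ⟨b | c, h⟩) <;> rfl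

/-- Inserting into a vertex that came from `y` amounts to inserting into `y` beforehand. Both sides
carry the order $E(x)\wedge E(y)\wedge E(z)$, so no sign and no parity condition appears. -/
theorem unlabel_insertAt_inl (v : V₂) (w : V₃) (x : LGra V₁) (y : LGra V₂) (z : LGra V₃) :
    unlabel _ (insertAt (Sum.inl v : Blow V₂ V₃ w) x (insertAt w y z)) =
      unlabel _ (insertAt w (insertAt v x y) z) := by
  rw [← unlabel_push (blowNested V₁ v w)]
  simp only [insertAt_apply, map_mul, push_push, redirect_redirect, mul_assoc]
  congr 2
  congr 1
  -- The edges of `y` are handled by base change along the inclusion of the blown-up `y`; those of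
  -- `z` by the equality of the two composite collapses.
  · rw [redirect_push_of_pullback (collapse V₁ v) _ Function.Embedding.inl
      (Function.Embedding.inl.trans (blowNested V₁ v w).toEmbedding)]
    · rintro (a | b) <;> rfl
    · rintro (a | ⟨b | c, h⟩) u hu
      · exact ⟨.inl a, rfl⟩
      · exact ⟨.inr ⟨b, fun h' => h (congrArg _ h')⟩, rfl⟩
      · exact absurd hu Sum.inr_ne_inl
  · have h := redirect_push (collapse (Blow V₁ V₂ v) w)
      (collapse V₂ w ∘ collapse V₁ (Sum.inl v : Blow V₂ V₃ w)) (Equiv.refl V₃)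
      (blowNested V₁ v w) (by rintro ((a | b) | c) <;> rfl) z
    rw [← h]
    congr 1
    exact (push_refl z).symm

/-- Insertion into two distinct vertices of a graph: the two orders of the vertex sets. -/
def blowSwap (V₁ V₂ : Type) {V₃ : Type} (w t : V₃) (h : t ≠ w) :
    Blow V₁ (Blow V₂ V₃ w) (Sum.inr ⟨t, h⟩) ≃ Blow V₂ (Blow V₁ V₃ t) (Sum.inr ⟨w, h.symm⟩) where
  toFun
    | .inl a => .inr ⟨.inl a, Sum.inl_ne_inr⟩
    | .inr ⟨.inl b, _⟩ => .inl b
    | .inr ⟨.inr c, hc⟩ => .inr ⟨.inr ⟨c.1, fun h' => hc (congrArg _ (Subtype.ext h'))⟩,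
        fun h' => c.2 (congrArg Subtype.val (Sum.inr_injective h'))⟩
  invFun
    | .inl a => .inr ⟨.inl a, Sum.inl_ne_inr⟩
    | .inr ⟨.inl b, _⟩ => .inl b
    | .inr ⟨.inr c, hc⟩ => .inr ⟨.inr ⟨c.1, fun h' => hc (congrArg _ (Subtype.ext h'))⟩,
        fun h' => c.2 (congrArg Subtype.val (Sum.inr_injective h'))⟩
  left_inv := by rintro (a | ⟨b | c, hc⟩) <;> rfl
  right_inv := by rintro (a | ⟨b | c, hc⟩) <;> rfl

/-- The inclusion of the graph inserted first when another graph is inserted elsewhere. -/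
def inrInl (V₁ V₂ : Type) {V₃ : Type} (w t : V₃) (h : t ≠ w) :
    V₂ ↪ Blow V₁ (Blow V₂ V₃ w) (Sum.inr ⟨t, h⟩) where
  toFun b := .inr ⟨.inl b, Sum.inl_ne_inr⟩
  inj' _ _ h := Sum.inl_injective (congrArg Subtype.val (Sum.inr_injective h))

/-- The vertex being blown up lies outside the inserted copy of `y`, so no edge of `y` is
redirected. -/
theorem redirect_push_inl_of_ne (w t : V₃) (h : t ≠ w) (y : LGra V₂) :
    redirect (collapse V₁ (Sum.inr ⟨t, h⟩ : Blow V₂ V₃ w)) (push Function.Embedding.inl y) =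
      push (inrInl V₁ V₂ w t h) y := by
  apply redirect_push_section
  · intro b
    rfl
  · rintro (a | ⟨b | c, hc⟩) u hu
    · exact absurd hu Sum.inr_ne_inl
    · exact ⟨b, rfl⟩
    · exact absurd hu Sum.inr_ne_inl

/-- The two results differ only by the order of $E(x)$ and $E(y)$ in the wedge product, and `x` is
central. -/
theorem unlabel_insertAt_inr [DecidableEq V₁] (w t : V₃) (h : t ≠ w) (x : LGra V₁) (y : LGra V₂) (z : LGra V₃)
    (hx : x ∈ evenAlg (Edge V₁ →₀ ℝ)) :
    unlabel _ (insertAt (Sum.inr ⟨t, h⟩ : Blow V₂ V₃ w) x (insertAt w y z)) =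
      unlabel _ (insertAt (Sum.inr ⟨w, h.symm⟩ : Blow V₁ V₃ t) y (insertAt t x z)) := by
  rw [← unlabel_push (blowSwap V₁ V₂ w t h)]
  simp only [insertAt_apply, map_mul, push_push, redirect_redirect, redirect_push_inl_of_ne,
    ← mul_assoc]
  congr 2
  · rw [evenAlg_comm (push_mem_evenAlg _ hx)]
    rfl
  · have h := redirect_push (collapse V₂ w ∘ collapse V₁ (Sum.inr ⟨t, h⟩ : Blow V₂ V₃ w))
      (collapse V₁ t ∘ collapse V₂ (Sum.inr ⟨w, h.symm⟩ : Blow V₁ V₃ t)) (Equiv.refl V₃)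
      (blowSwap V₁ V₂ w t h) (by rintro (a | ⟨b | c, hc⟩) <;> rfl) z
    rw [← h]
    congr 1
    exact push_refl z

theorem ins_preLie_unlabel [DecidableEq V₁] (x : LGra V₁) (y : LGra V₂) (z : LGra V₃)
    (hx : x ∈ evenAlg (Edge V₁ →₀ ℝ)) :
    ins (unlabel _ x) (ins (unlabel _ y) (unlabel _ z)) -
        ins (ins (unlabel _ x) (unlabel _ y)) (unlabel _ z) =
      ins (unlabel _ y) (ins (unlabel _ x) (unlabel _ z)) -
        ins (ins (unlabel _ y) (unlabel _ x)) (unlabel _ z) := by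
  -- The insertions of `x` into vertices of `y` cancel against $(x\circ y)\circ z$; what survives is
  -- the insertion into two distinct vertices `w` and `t` of `z`.
  have key : ∀ {V₁ V₂ : Type} [Fintype V₁] [Fintype V₂] [DecidableEq V₁] [DecidableEq V₂]
      (x : LGra V₁) (y : LGra V₂),
      ins (unlabel _ x) (ins (unlabel _ y) (unlabel _ z)) -
        ins (ins (unlabel _ x) (unlabel _ y)) (unlabel _ z) =
      ∑ w : V₃, ∑ t : {t : V₃ // t ≠ w},
        unlabel _ (insertAt (Sum.inr t : Blow V₂ V₃ w) x (insertAt w y z)) := by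
    intro V₁ V₂ _ _ _ _ x y
    simp only [ins_unlabel, map_sum, LinearMap.sum_apply, Fintype.sum_sum_type,
      unlabel_insertAt_inl, Finset.sum_add_distrib]
    rw [Finset.sum_comm (γ := V₂), add_sub_cancel_left]
  rw [key, key]
  simp only [Finset.sum_sigma']
  -- The bijection exchanges the two distinct vertices of `z`.
  refine Finset.sum_bij' (fun p _ => ⟨p.2.1, ⟨p.1, p.2.2.symm⟩⟩)
    (fun p _ => ⟨p.2.1, ⟨p.1, p.2.2.symm⟩⟩) ?_ ?_ ?_ ?_ ?_
  · simp
  · simp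
  · intros; rfl
  · intros; rfl
  · rintro ⟨w, t, h⟩ _
    exact unlabel_insertAt_inr w t h x y z hx

end PreLie

/-! ## The Lie bracket -/

/-- Formal sums of graphs with an even number of edges. -/
def evenGra : Submodule ℝ Gra :=
  Submodule.span ℝ {γ | ∃ n, ∃ x ∈ evenAlg (Edge (Fin n) →₀ ℝ), γ = unlabel (Fin n) x}

theorem unlabel_mem_evenGra {V : Type} [Fintype V] {x : LGra V}
    (hx : x ∈ evenAlg (Edge V →₀ ℝ)) : unlabel V x ∈ evenGra := by
  rw [← unlabel_push (Fintype.equivFin V)]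
  exact Submodule.subset_span ⟨_, _, push_mem_evenAlg _ hx, rfl⟩

theorem ins_mem_evenGra {a b : Gra} (ha : a ∈ evenGra) (hb : b ∈ evenGra) :
    ins a b ∈ evenGra := by
  induction ha using Submodule.span_induction with
  | zero => simp
  | add a a' _ _ ha ha' => simpa using add_mem ha ha'
  | smul c a _ ha => simpa using Submodule.smul_mem _ c ha
  | mem a ha =>
    obtain ⟨n, x, hx, rfl⟩ := ha
    induction hb using Submodule.span_induction with
    | zero => simp
    | add a a' _ _ ha ha' => simpa using add_mem ha ha'
    | smul c a _ ha => simpa using Submodule.smul_mem _ c ha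
    | mem b hb =>
      obtain ⟨m, y, hy, rfl⟩ := hb
      rw [ins_unlabel]
      exact sum_mem fun v _ => unlabel_mem_evenGra
        (mul_mem (push_mem_evenAlg _ hx) (redirect_mem_evenAlg _ hy))

/-- Even monomials commute with everything, so the two edge orders agree; with its right-hand
analogue this turns the bracket into a commutator of `ins`. -/
theorem insRev_eq_ins_left {a : Gra} (ha : a ∈ evenGra) (b : Gra) : insRev a b = ins a b := by
  induction ha using Submodule.span_induction with
  | zero => simp
  | add a a' _ _ ha ha' => simp [ha, ha']
  | smul c a _ ha => simp [ha]
  | mem a ha =>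
    obtain ⟨n, x, hx, rfl⟩ := ha
    induction b using gra_induction with
    | zero => simp
    | add b b' hb hb' => simp [hb, hb']
    | unlabel m y =>
      simp only [insRev, ins, descend_unlabel, insertLab_apply, insertLab'_apply,
        insertAt_apply, insertAt'_apply, evenAlg_comm (push_mem_evenAlg _ hx)]

theorem insRev_eq_ins_right (a : Gra) {b : Gra} (hb : b ∈ evenGra) : insRev a b = ins a b := by
  induction hb using Submodule.span_induction with
  | zero => simp
  | add b b' _ _ hb hb' => simp [hb, hb']
  | smul c b _ hb => simp [hb]
  | mem b hb =>
    obtain ⟨m, y, hy, rfl⟩ := hb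
    induction a using gra_induction with
    | zero => simp
    | add a a' ha ha' => simp [ha, ha']
    | unlabel n x =>
      simp only [insRev, ins, descend_unlabel, insertLab_apply, insertLab'_apply,
        insertAt_apply, insertAt'_apply, evenAlg_comm (redirect_mem_evenAlg _ hy)]

theorem bracket_even_right (a : Gra) {b : Gra} (hb : b ∈ evenGra) :
    bracket a b = ins a b - ins b a := by
  rw [bracket_apply, insRev_eq_ins_left hb]

theorem bracket_even_left {a : Gra} (ha : a ∈ evenGra) (b : Gra) :
    bracket a b = ins a b - ins b a := by
  rw [bracket_apply, insRev_eq_ins_right b ha]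

theorem bracket_mem_evenGra {a b : Gra} (ha : a ∈ evenGra) (hb : b ∈ evenGra) :
    bracket a b ∈ evenGra := by
  rw [bracket_even_right a hb]
  exact sub_mem (ins_mem_evenGra ha hb) (ins_mem_evenGra hb ha)

/-- Insertion of graphs is a left pre-Lie operation. -/
theorem ins_preLie {a : Gra} (ha : a ∈ evenGra) (b c : Gra) :
    ins a (ins b c) - ins (ins a b) c = ins b (ins a c) - ins (ins b a) c := by
  induction ha using Submodule.span_induction with
  | zero => simp
  | add a a' _ _ ha ha' =>
    simp only [map_add, LinearMap.add_apply, add_sub_add_comm, ha, ha']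
  | smul r a _ ha => simp only [map_smul, LinearMap.smul_apply, ← smul_sub, ha]
  | mem a ha =>
    obtain ⟨n, x, hx, rfl⟩ := ha
    induction b using gra_induction with
    | zero => simp
    | add b b' hb hb' => simp only [map_add, LinearMap.add_apply, add_sub_add_comm, hb, hb']
    | unlabel m y =>
      induction c using gra_induction with
      | zero => simp
      | add c c' hc hc' => simp only [map_add, add_sub_add_comm, hc, hc']
      | unlabel k z => exact ins_preLie_unlabel x y z hx

/-- The parity of `a` is left free so that `a` may be the one-edge graph. This is possible because
each instance of the pre-Lie identity used below has `b` or `c` as its even first argument. -/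
theorem bracket_jacobi (a : Gra) {b c : Gra} (hb : b ∈ evenGra) (hc : c ∈ evenGra) :
    bracket a (bracket b c) = bracket (bracket a b) c + bracket b (bracket a c) := by
  rw [bracket_even_right a (bracket_mem_evenGra hb hc), bracket_even_right (bracket a b) hc,
    bracket_even_left hb (bracket a c), bracket_even_right b hc, bracket_even_right a hb,
    bracket_even_right a hc]
  have h1 := ins_preLie hb a c
  have h2 := ins_preLie hc a b
  have h3 := ins_preLie hb c a
  simp only [map_sub, LinearMap.sub_apply]
  rw [← sub_eq_zero] at h1 h2 h3 ⊢
  -- The Jacobi expression is the combination `h2 - h1 + h3` of the three vanishing differences.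
  have h := congrArg₂ (· + ·) (congrArg₂ (· - ·) h2 h1) h3
  simp only [sub_zero, add_zero] at h
  rw [← h]
  abel

theorem bracket_skew (a : Gra) {b : Gra} (hb : b ∈ evenGra) : bracket a b = -bracket b a := by
  rw [bracket_even_right a hb, bracket_even_left hb, neg_sub]

theorem graph_mem_evenGra {n : ℕ} {l : List (Edge (Fin n))} (hl : Even l.length) :
    graph n l ∈ evenGra := by
  apply unlabel_mem_evenGra
  have := list_prod_mem_evenAlg (l.map fun e => (Finsupp.single e (1 : ℝ))) (by simpa using hl)
  rwa [List.map_map] at this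

theorem homogeneous_le_evenGra (n : ℕ) {m : ℕ} (hm : Even m) : homogeneous n m ≤ evenGra := by
  refine Submodule.span_le.2 ?_
  rintro _ ⟨l, rfl, -, -, rfl⟩
  exact graph_mem_evenGra hm

theorem cocycles_le_evenGra : cocycles ≤ evenGra :=
  inf_le_left.trans (iSup_le fun _ => homogeneous_le_evenGra _ (even_two_mul _))

/-! ## The bi-grading -/

/-- With this, lists of redirected edges need not be checked for repetitions: a list that has one
contributes zero, which lies in every homogeneous component. -/
theorem prod_edgeGen_eq_zero {V : Type} {l : List (Edge V)} (hl : ¬ l.Nodup) :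
    (l.map edgeGen).prod = 0 := by
  rw [List.nodup_iff_injective_get, Function.Injective] at hl
  push Not at hl
  obtain ⟨i, j, hij, hne⟩ := hl
  have h := AlternatingMap.map_eq_zero_of_eq (ExteriorAlgebra.ιMulti ℝ l.length)
    (fun i => Finsupp.single (l.get i) (1 : ℝ)) (by simp only [hij]) hne
  rw [ExteriorAlgebra.ιMulti_apply] at h
  rw [← h]
  congr 1
  conv_lhs => rw [← List.ofFn_get l, List.map_ofFn]
  rfl

-- Expanding the product of sums leaves graphs whose edges lift the given ones one by one, so that
-- the number of edges and connectedness can be read off from lists.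
open Classical in
theorem redirect_list_prod_mem_span {V W : Type} [Fintype W] (π : W → V) (l : List (Edge V)) :
    redirect π (l.map edgeGen).prod ∈ Submodule.span ℝ
      {z | ∃ l' : List (Edge W), List.Forall₂ (fun e' e => e'.1.map π = e.1) l' l ∧
        z = (l'.map edgeGen).prod} := by
  induction l with
  | nil => exact Submodule.subset_span ⟨[], by simp, by simp⟩
  | cons e l ih =>
    rw [List.map_cons, List.prod_cons, map_mul, redirect_edgeGen, Finset.sum_mul]
    refine sum_mem fun e' he' => ?_
    have he' := (Finset.mem_filter.1 he').2
    generalize redirect π (l.map edgeGen).prod = y at ih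
    induction ih using Submodule.span_induction with
    | zero => simp
    | add a b _ _ ha hb => simpa [mul_add] using add_mem ha hb
    | smul c a _ ha => simpa using Submodule.smul_mem _ c ha
    | mem a ha =>
      obtain ⟨l', hl', rfl⟩ := ha
      exact Submodule.subset_span ⟨e' :: l', List.Forall₂.cons he' hl', by simp⟩

/-- The graph with the given list of edges, as a simple graph. -/
abbrev skeleton {V : Type} (l : List (Edge V)) : SimpleGraph V :=
  SimpleGraph.fromEdgeSet {e | e ∈ l.map Subtype.val}

theorem skeleton_adj {V : Type} {l : List (Edge V)} {v w : V} :
    (skeleton l).Adj v w ↔ ∃ e ∈ l, e.1 = s(v, w) := by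
  rw [SimpleGraph.fromEdgeSet_adj]
  constructor
  · rintro ⟨h, -⟩
    exact List.mem_map.1 h
  · rintro ⟨e, he, hvw⟩
    refine ⟨List.mem_map.2 ⟨e, he, hvw⟩, fun h => e.2 ?_⟩
    rw [hvw, h]
    simp

/-- Transport of skeletons along an injective map of vertices. -/
def skeletonHom {V W : Type} (f : V ↪ W) {l : List (Edge V)} {l' : List (Edge W)}
    (h : ∀ e ∈ l, e.map f ∈ l') : skeleton l →g skeleton l' where
  toFun := f
  map_rel' := by
    intro v w hvw
    obtain ⟨e, he, hvw⟩ := skeleton_adj.1 hvw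
    exact skeleton_adj.2 ⟨_, h e he, by simp [hvw]⟩

theorem unlabel_mem_homogeneous {V : Type} [Fintype V] {n m : ℕ} (l : List (Edge V))
    (hn : Fintype.card V = n) (hm : l.length = m) (hl : l.Nodup → (skeleton l).Connected) :
    unlabel V (l.map edgeGen).prod ∈ homogeneous n m := by
  by_cases hd : l.Nodup
  · subst hn hm
    rw [← unlabel_push (Fintype.equivFin V), map_list_prod, List.map_map]
    set f := (Fintype.equivFin V).toEmbedding
    refine Submodule.subset_span ⟨l.map (Edge.map f), by simp, ?_, ?_, ?_⟩
    · refine hd.map fun a b hab => Subtype.ext ?_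
      exact Sym2.map.injective f.injective (congrArg Subtype.val hab)
    · exact (hl hd).map (skeletonHom f fun e he => List.mem_map_of_mem he)
        (Fintype.equivFin V).surjective
    · simp only [graph, List.map_map]
      congr 3
      funext e
      simp
  · rw [prod_edgeGen_eq_zero hd, map_zero]
    exact zero_mem _

/-- A walk in the base is lifted edge by edge, moving inside a fibre whenever the end of one lifted
edge is not the start of the next. -/
theorem connected_of_fibers {V W : Type} {G : SimpleGraph V} {H : SimpleGraph W} (π : W → V)
    [Nonempty W] (hf : ∀ w w', π w = π w' → H.Reachable w w')
    (hl : ∀ p q, G.Adj p q → ∃ w w', π w = p ∧ π w' = q ∧ H.Adj w w') (hG : G.Connected) :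
    H.Connected := by
  refine ⟨fun w w' => ?_⟩
  have h := (SimpleGraph.reachable_iff_reflTransGen _ _).1 (hG.preconnected (π w) (π w'))
  have key : ∀ p, Relation.ReflTransGen G.Adj (π w) p → ∀ u, π u = p → H.Reachable w u := by
    intro p hp
    induction hp with
    | refl => exact fun u hu => hf _ _ hu.symm
    | tail _ hpq ih =>
      intro u hu
      obtain ⟨a, b, ha, hb, hab⟩ := hl _ _ hpq
      exact ((ih a ha).trans hab.reachable).trans (hf _ _ (hb.trans hu.symm))
  exact key _ h _ rfl

/-- The fibre of `collapse` over `v` is the connected inserted graph, and every other fibre is a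
single point. -/
theorem skeleton_blow_connected {V₁ V₂ : Type} {v : V₂} {l₁ : List (Edge V₁)}
    {l₂ : List (Edge V₂)} {l' : List (Edge (Blow V₁ V₂ v))} (h₁ : (skeleton l₁).Connected)
    (h₂ : (skeleton l₂).Connected)
    (hl' : List.Forall₂ (fun e' e => e'.1.map (collapse V₁ v) = e.1) l' l₂) :
    (skeleton (l₁.map (Edge.map Function.Embedding.inl) ++ l')).Connected := by
  obtain ⟨v₁⟩ := h₁.nonempty
  have : Nonempty (Blow V₁ V₂ v) := ⟨.inl v₁⟩
  refine connected_of_fibers (collapse V₁ v) ?_ ?_ h₂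
  · rintro (a | b) (a' | b') h
    · exact (h₁.preconnected a a').map (skeletonHom Function.Embedding.inl fun e he =>
        List.mem_append_left _ (List.mem_map_of_mem he))
    · exact absurd h.symm b'.2
    · exact absurd h b.2
    · rw [Subtype.ext h]
  · intro p q hpq
    obtain ⟨e, he, hpq⟩ := skeleton_adj.1 hpq
    obtain ⟨i, hi, rfl⟩ := List.mem_iff_getElem.1 he
    have hi' : i < l'.length := by rw [hl'.length_eq]; exact hi
    have hmap := List.forall₂_iff_get.1 hl' |>.2 i hi' hi
    have hmem : l'.get ⟨i, hi'⟩ ∈ l' := List.get_mem _ _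
    generalize l'.get ⟨i, hi'⟩ = e' at hmap hmem
    obtain ⟨e', hd⟩ := e'
    induction e' with | _ w w'
    have hmap : s(collapse V₁ v w, collapse V₁ v w') = s(p, q) := hmap.trans hpq
    have hadj : (skeleton (l₁.map (Edge.map Function.Embedding.inl) ++ l')).Adj w w' :=
      skeleton_adj.2 ⟨_, List.mem_append_right _ hmem, rfl⟩
    rcases Sym2.eq_iff.1 hmap with ⟨h, h'⟩ | ⟨h, h'⟩
    · exact ⟨w, w', h, h', hadj⟩
    · exact ⟨w', w, h', h, hadj.symm⟩

/-- One of the `k + 1` vertices of the host is replaced by `n` vertices; writing `k + 1` avoids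
truncated subtraction. -/
theorem ins_mem_homogeneous {n k p q : ℕ} {a b : Gra} (ha : a ∈ homogeneous n p)
    (hb : b ∈ homogeneous (k + 1) q) : ins a b ∈ homogeneous (n + k) (p + q) := by
  induction ha using Submodule.span_induction with
  | zero => simp
  | add a a' _ _ ha ha' => simpa using add_mem ha ha'
  | smul c a _ ha => simpa using Submodule.smul_mem _ c ha
  | mem a ha =>
    obtain ⟨l₁, rfl, -, h₁, rfl⟩ := ha
    induction hb using Submodule.span_induction with
    | zero => simp
    | add a a' _ _ ha ha' => simpa using add_mem ha ha'
    | smul c a _ ha => simpa using Submodule.smul_mem _ c ha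
    | mem b hb =>
      obtain ⟨l₂, rfl, -, h₂, rfl⟩ := hb
      rw [graph, graph, ins_unlabel]
      refine sum_mem fun v _ => ?_
      rw [insertAt_apply]
      have := redirect_list_prod_mem_span (collapse (Fin n) v) l₂
      generalize redirect (collapse (Fin n) v) (l₂.map edgeGen).prod = y at this
      induction this using Submodule.span_induction with
      | zero => simp
      | add a a' _ _ ha ha' => simpa [mul_add] using add_mem ha ha'
      | smul c a _ ha => simpa using Submodule.smul_mem _ c ha
      | mem z hz =>
        obtain ⟨l', hl', rfl⟩ := hz
        have hprod : push (Function.Embedding.inl : _ ↪ Blow (Fin n) (Fin (k + 1)) v)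
            (l₁.map edgeGen).prod * (l'.map edgeGen).prod =
            ((l₁.map (Edge.map Function.Embedding.inl) ++ l').map edgeGen).prod := by
          rw [List.map_append, List.prod_append, map_list_prod, List.map_map, List.map_map]
          congr 3
          funext e
          simp
        rw [hprod]
        refine unlabel_mem_homogeneous _ ?_ ?_ fun _ => skeleton_blow_connected h₁ h₂ hl'
        · simp [Fintype.card_subtype_compl]
        · simp [hl'.length_eq]

theorem bracket_mem_homogeneous {j k : ℕ} {a b : Gra} (ha : a ∈ homogeneous (j + 1) (2 * j))
    (hb : b ∈ homogeneous (k + 1) (2 * k)) :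
    bracket a b ∈ homogeneous (j + k + 1) (2 * (j + k)) := by
  rw [bracket_even_right a (homogeneous_le_evenGra _ (even_two_mul _) hb)]
  have h₁ := ins_mem_homogeneous ha hb
  have h₂ := ins_mem_homogeneous hb ha
  rw [show j + 1 + k = j + k + 1 by ring, ← mul_add] at h₁
  rw [show k + 1 + j = j + k + 1 by ring, ← mul_add, add_comm k j] at h₂
  exact sub_mem h₁ h₂

theorem bracket_mem_cocycles {a b : Gra} (ha : a ∈ cocycles) (hb : b ∈ cocycles) :
    bracket a b ∈ cocycles := by
  refine mem_cocycles.2 ⟨?_, ?_⟩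
  · replace ha := (mem_cocycles.1 ha).1
    replace hb := (mem_cocycles.1 hb).1
    induction ha using Submodule.iSup_induction' with
    | zero => simp
    | add a a' _ _ ha ha' => simpa using add_mem ha ha'
    | mem j a ha =>
      induction hb using Submodule.iSup_induction' with
      | zero => simp
      | add b b' _ _ hb hb' => simpa using add_mem hb hb'
      | mem k b hb =>
        exact Submodule.mem_iSup_of_mem (j + k) (bracket_mem_homogeneous ha hb)
  -- The Jacobi identity with the stick says that the differential is a derivation of the bracket.
  · rw [bracket_jacobi stick (cocycles_le_evenGra ha) (cocycles_le_evenGra hb),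
      (mem_cocycles.1 ha).2, (mem_cocycles.1 hb).2]
    simp

/-! ## Derivations of superfunctions -/

section Leibniz

variable {E F : Type} [NormedAddCommGroup E] [NormedSpace ℝ E] [NormedAddCommGroup F]
  [NormedSpace ℝ F]

theorem derivSmooth_mul (v : E) (f g : Smooth E) :
    derivSmooth v (f * g) = derivSmooth v f * g + f * derivSmooth v g := by
  apply Subtype.ext
  funext x
  have hf : DifferentiableAt ℝ f.1 x := ((smooth_contDiff f).differentiable (by simp)) x
  have hg : DifferentiableAt ℝ g.1 x := ((smooth_contDiff g).differentiable (by simp)) x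
  change fderiv ℝ (f.1 * g.1) x v = fderiv ℝ f.1 x v * g.1 x + f.1 x * fderiv ℝ g.1 x v
  rw [fderiv_mul hf hg]
  simp
  ring

theorem dX_mul (v : E) (a b : Multi E) : dX v (a * b) = dX v a * b + a * dX v b := by
  induction a using TensorProduct.induction_on with
  | zero => simp
  | add a a' ha ha' => rw [add_mul, map_add, ha, ha', map_add, add_mul, add_mul]; abel
  | tmul f w =>
    induction b using TensorProduct.induction_on with
    | zero => simp
    | add b b' hb hb' => rw [mul_add, map_add, hb, hb', map_add, mul_add, mul_add]; abel
    | tmul g u =>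
      simp only [dX, Algebra.TensorProduct.tmul_mul_tmul, LinearMap.rTensor_tmul,
        derivSmooth_mul, TensorProduct.add_tmul]

theorem contractLeft_mul (φ : Module.Dual ℝ E) (w u : ExteriorAlgebra ℝ E) :
    CliffordAlgebra.contractLeft (Q := (0 : QuadraticForm ℝ E)) φ (w * u) =
      CliffordAlgebra.contractLeft (Q := (0 : QuadraticForm ℝ E)) φ w * u +
        CliffordAlgebra.involute w *
          CliffordAlgebra.contractLeft (Q := (0 : QuadraticForm ℝ E)) φ u := by
  induction w using CliffordAlgebra.left_induction with
  | algebraMap r =>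
    rw [CliffordAlgebra.contractLeft_algebraMap, zero_mul, zero_add, AlgHom.commutes]
    exact CliffordAlgebra.contractLeft_algebraMap_mul _ _ _
  | add a b ha hb =>
    rw [add_mul, map_add, ha, hb, map_add, map_add, add_mul, add_mul]
    abel
  | ι_mul a m ha =>
    rw [mul_assoc, CliffordAlgebra.contractLeft_ι_mul, ha, CliffordAlgebra.contractLeft_ι_mul,
      map_mul, CliffordAlgebra.involute_ι, sub_mul, mul_add, smul_mul_assoc, neg_mul, neg_mul,
      mul_assoc, mul_assoc]
    abel

/-- The grade involution `ξ ↦ -ξ` of superfunctions. -/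
def gradeInv (E : Type) [NormedAddCommGroup E] [NormedSpace ℝ E] : Multi E →ₐ[ℝ] Multi E :=
  Algebra.TensorProduct.map (AlgHom.id ℝ _)
    (CliffordAlgebra.involute (Q := (0 : QuadraticForm ℝ E)))

theorem dXi_mul (φ : Module.Dual ℝ E) (a b : Multi E) :
    dXi φ (a * b) = dXi φ a * b + gradeInv E a * dXi φ b := by
  induction a using TensorProduct.induction_on with
  | zero => simp
  | add a a' ha ha' => rw [add_mul, map_add, ha, ha', map_add, map_add, add_mul, add_mul]; abel
  | tmul f w =>
    induction b using TensorProduct.induction_on with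
    | zero => simp
    | add b b' hb hb' => rw [mul_add, map_add, hb, hb', map_add, mul_add, mul_add]; abel
    | tmul g u =>
      simp only [dXi, gradeInv, Algebra.TensorProduct.tmul_mul_tmul, LinearMap.lTensor_tmul,
        Algebra.TensorProduct.map_tmul, AlgHom.id_apply]
      rw [contractLeft_mul, TensorProduct.tmul_add]

theorem dX_one (v : E) : dX v (1 : Multi E) = 0 := by
  have := dX_mul v (1 : Multi E) 1
  rw [mul_one, mul_one, one_mul] at this
  exact left_eq_add.1 this

theorem dXi_one (φ : Module.Dual ℝ E) : dXi φ (1 : Multi E) = 0 := by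
  have := dXi_mul φ (1 : Multi E) 1
  rw [mul_one, mul_one, map_one (gradeInv E), one_mul] at this
  exact left_eq_add.1 this

theorem dX_zero : dX (0 : E) = 0 := by
  apply TensorProduct.ext'
  intro f w
  have : derivSmooth (0 : E) f = 0 := by
    apply Subtype.ext
    funext x
    exact map_zero _
  simp [dX, this]

theorem dX_add (v w : E) : dX (v + w) = dX v + dX w := by
  apply TensorProduct.ext'
  intro f u
  have : derivSmooth (v + w) f = derivSmooth v f + derivSmooth w f := by
    apply Subtype.ext
    funext x
    exact map_add _ _ _
  simp [dX, this, TensorProduct.add_tmul]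

theorem dX_sum {ι : Type*} (s : Finset ι) (v : ι → E) :
    dX (∑ i ∈ s, v i) = ∑ i ∈ s, dX (v i) := by
  classical
  induction s using Finset.induction_on with
  | empty => rw [Finset.sum_empty, Finset.sum_empty, dX_zero]
  | insert i s hi ih => rw [Finset.sum_insert hi, Finset.sum_insert hi, dX_add, ih]

theorem dXi_zero : dXi (0 : Module.Dual ℝ E) = 0 := by
  simp [dXi]

theorem dXi_add (φ ψ : Module.Dual ℝ E) : dXi (φ + ψ) = dXi φ + dXi ψ := by
  simp [dXi, LinearMap.lTensor_add]

theorem dXi_sum {ι : Type*} (s : Finset ι) (φ : ι → Module.Dual ℝ E) :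
    dXi (∑ i ∈ s, φ i) = ∑ i ∈ s, dXi (φ i) := by
  classical
  induction s using Finset.induction_on with
  | empty => rw [Finset.sum_empty, Finset.sum_empty, dXi_zero]
  | insert i s hi ih => rw [Finset.sum_insert hi, Finset.sum_insert hi, dXi_add, ih]

/-! ## Even superfunctions -/

/-- The subalgebra of even superfunctions. -/
def evenMulti (E : Type) [NormedAddCommGroup E] [NormedSpace ℝ E] : Subalgebra ℝ (Multi E) :=
  (Algebra.TensorProduct.map (AlgHom.id ℝ (Smooth E)) (evenAlg E).val).range

theorem tmul_mem_evenMulti (f : Smooth E) {w : ExteriorAlgebra ℝ E} (hw : w ∈ evenAlg E) :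
    f ⊗ₜ[ℝ] w ∈ evenMulti E :=
  ⟨f ⊗ₜ ⟨w, hw⟩, rfl⟩

@[elab_as_elim]
theorem evenMulti_induction {motive : (a : Multi E) → a ∈ evenMulti E → Prop}
    (zero : motive 0 (zero_mem _))
    (add : ∀ a b ha hb, motive a ha → motive b hb → motive (a + b) (add_mem ha hb))
    (tmul : ∀ (f : Smooth E) (w : ExteriorAlgebra ℝ E) (hw : w ∈ evenAlg E),
      motive (f ⊗ₜ[ℝ] w) (tmul_mem_evenMulti f hw)) {a : Multi E} (ha : a ∈ evenMulti E) :
    motive a ha := by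
  have key : ∀ t (h : Algebra.TensorProduct.map (AlgHom.id ℝ (Smooth E)) (evenAlg E).val t ∈
      evenMulti E), motive _ h := by
    intro t
    induction t using TensorProduct.induction_on with
    | zero =>
      rw [map_zero]
      exact fun _ => zero
    | add a b ha hb =>
      rw [map_add]
      exact fun _ => add _ _ ⟨a, rfl⟩ ⟨b, rfl⟩ (ha _) (hb _)
    | tmul f w => exact fun _ => tmul f w.1 w.2
  obtain ⟨t, rfl⟩ := ha
  exact key t _

theorem evenMulti_comm {a : Multi E} (ha : a ∈ evenMulti E) (b : Multi E) : a * b = b * a := by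
  induction ha using evenMulti_induction with
  | zero => simp
  | add a a' _ _ ha ha' => rw [add_mul, mul_add, ha, ha']
  | tmul f w hw =>
    induction b using TensorProduct.induction_on with
    | zero => simp
    | add b b' hb hb' => rw [mul_add, add_mul, hb, hb']
    | tmul g u =>
      rw [Algebra.TensorProduct.tmul_mul_tmul, Algebra.TensorProduct.tmul_mul_tmul, mul_comm f,
        evenAlg_comm hw]

/-- Commutativity allows unordered products over the vertices, and polynomials with coefficients in
even superfunctions when velocities are computed. -/
instance evenMultiCommRing : CommRing (evenMulti E) :=
  { (evenMulti E).toRing with mul_comm := fun a b => Subtype.ext (evenMulti_comm a.2 b.1) }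

theorem gradeInv_eq_self {a : Multi E} (ha : a ∈ evenMulti E) : gradeInv E a = a := by
  induction ha using evenMulti_induction with
  | zero => simp
  | add a a' _ _ ha ha' => rw [map_add, ha, ha']
  | tmul f w hw =>
    have h : evenAlg E ≤ AlgHom.equalizer
        (CliffordAlgebra.involute (Q := (0 : QuadraticForm ℝ E))) (AlgHom.id ℝ _) := by
      refine Algebra.adjoin_le ?_
      rintro _ ⟨a, b, rfl⟩
      change CliffordAlgebra.involute (CliffordAlgebra.ι (0 : QuadraticForm ℝ E) a *
        CliffordAlgebra.ι _ b) = CliffordAlgebra.ι (0 : QuadraticForm ℝ E) a *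
        CliffordAlgebra.ι _ b
      rw [map_mul, CliffordAlgebra.involute_ι, CliffordAlgebra.involute_ι, neg_mul_neg]
    have hw : CliffordAlgebra.involute w = w := h hw
    simp only [gradeInv, Algebra.TensorProduct.map_tmul, AlgHom.id_apply, hw]

theorem subst_mem_evenMulti (L : E →L[ℝ] F) (M : F →ₗ[ℝ] E) {a : Multi F}
    (ha : a ∈ evenMulti F) : subst L M a ∈ evenMulti E := by
  induction ha using evenMulti_induction with
  | zero => simp
  | add a a' _ _ ha ha' => rw [map_add]; exact add_mem ha ha'
  | tmul f w hw => exact tmul_mem_evenMulti _ (map_mem_evenAlg M hw)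

end Leibniz

/-! ## Transport of the copies of variables along a map of vertices -/

section Transport

variable {V W X : Type} [Fintype V] [Fintype W] [Fintype X] [DecidableEq V] [DecidableEq W]
  [DecidableEq X] {d : ℕ}

/-- The superfunction of variables in the vertices `V`, read off at the vertices of `W`: the
variables in the vertex `v` are identified with those in `g v`. -/
def transport (g : V → W) : Multi (V → Pt d) →ₐ[ℝ] Multi (W → Pt d) :=
  subst (ContinuousLinearMap.pi fun v => ContinuousLinearMap.proj (g v))
    (∑ v : V, LinearMap.single ℝ (fun _ : W => Pt d) (g v) ∘ₗ
      LinearMap.proj (R := ℝ) (φ := fun _ : V => Pt d) v)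

theorem transport_place (g : V → W) (v : V) (a : Multi (Pt d)) :
    transport g (place v a) = place (g v) a := by
  simp only [transport, place, subst_subst]
  congr 2
  apply LinearMap.ext
  intro p
  simp only [LinearMap.comp_apply, LinearMap.sum_apply, LinearMap.proj_apply,
    LinearMap.coe_single]
  rw [Finset.sum_eq_single v]
  · simp
  · intro u _ hu
    simp [hu]
  · simp

theorem diagonal_transport (g : V → W) (a : Multi (V → Pt d)) :
    diagonal W d (transport g a) = diagonal V d a := by
  simp only [transport, diagonal, subst_subst]
  congr 2
  apply LinearMap.ext
  intro p
  simp only [LinearMap.comp_apply, LinearMap.sum_apply, LinearMap.proj_apply,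
    LinearMap.coe_single, Finset.sum_apply]
  rw [Finset.sum_comm]
  simp [Pi.single_apply]

/-- This is how the output of an inserted graph, restricted to its own diagonal, becomes the content
of the single vertex `v`. -/
theorem transport_const (v : W) (a : Multi (V → Pt d)) :
    transport (fun _ : V => v) a = place v (diagonal V d a) := by
  simp only [transport, place, diagonal, subst_subst]
  congr 2
  apply LinearMap.ext
  intro p
  simp only [LinearMap.comp_apply, LinearMap.sum_apply, LinearMap.proj_apply, map_sum]

theorem transport_transport (g : V → W) (h : W → X) (a : Multi (V → Pt d)) :
    transport h (transport g a) = transport (h ∘ g) a := by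
  simp only [transport, subst_subst]
  congr 2
  apply LinearMap.ext
  intro p
  simp only [LinearMap.comp_apply, LinearMap.sum_apply, LinearMap.proj_apply,
    LinearMap.coe_single, Finset.sum_apply, Function.comp_apply]
  funext x
  simp only [Finset.sum_apply, Pi.single_apply]
  have key : ∀ w, (if x = h w then ∑ v, if w = g v then p v else 0 else 0) =
      ∑ v, if w = g v then (if x = h w then p v else 0) else 0 := by
    intro w
    split_ifs <;> simp
  simp only [key]
  rw [Finset.sum_comm]
  simp

/-- Chain rule: the variables of all the vertices over `w` become the variables of `w`. The sum over
the fibre is the analytic counterpart of redirecting one end of an edge. -/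
theorem dXAt_transport (g : V → W) (w : W) (α : Fin d) (a : Multi (V → Pt d)) :
    dXAt w α (transport g a) =
      ∑ v : V with g v = w, transport g (dXAt v α a) := by
  rw [dXAt, transport, dX_subst, ← map_sum]
  congr 1
  rw [← LinearMap.sum_apply]
  simp only [dXAt]
  rw [← dX_sum]
  congr 2
  funext v
  rw [Finset.sum_apply]
  by_cases h : g v = w <;> simp [Pi.single_apply, h]

theorem dXiAt_transport (g : V → W) (w : W) (α : Fin d) (a : Multi (V → Pt d)) :
    dXiAt w α (transport g a) =
      ∑ v : V with g v = w, transport g (dXiAt v α a) := by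
  rw [dXiAt, transport, dXi_subst, ← map_sum]
  congr 1
  rw [← LinearMap.sum_apply]
  simp only [dXiAt]
  rw [← dXi_sum]
  congr 2
  apply LinearMap.ext
  intro p
  simp only [LinearMap.comp_apply, LinearMap.sum_apply, LinearMap.proj_apply,
    LinearMap.coe_single, Finset.sum_apply, Pi.single_apply, Finset.sum_filter]
  refine Finset.sum_congr rfl fun v _ => ?_
  by_cases h : g v = w
  · simp [h]
  · simp [h, Ne.symm h]

theorem dXAt_place_of_ne {v w : V} (h : v ≠ w) (α : Fin d) (a : Multi (Pt d)) :
    dXAt v α (place w a) = 0 := by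
  rw [dXAt, place, dX_subst]
  simp [dX_zero, Ne.symm h]

theorem dXiAt_place_of_ne {v w : V} (h : v ≠ w) (α : Fin d) (a : Multi (Pt d)) :
    dXiAt v α (place w a) = 0 := by
  rw [dXiAt, place, dXi_subst]
  have : (LinearMap.proj (R := ℝ) (φ := fun _ : Fin d => ℝ) α ∘ₗ
    LinearMap.proj (R := ℝ) (φ := fun _ : V => Pt d) v) ∘ₗ
    LinearMap.single ℝ (fun _ : V => Pt d) w = 0 := by
    apply LinearMap.ext
    intro p
    simp [h]
  rw [this, dXi_zero]
  simp

end Transport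

/-! ## Graph operators and maps of vertices -/

section GraphOp

variable {V W : Type} [Fintype V] [Fintype W] [DecidableEq V] [DecidableEq W] {d : ℕ}

@[elab_as_elim]
theorem lgra_induction {V : Type} {motive : LGra V → Prop} (x : LGra V)
    (scalar : ∀ r : ℝ, motive (algebraMap ℝ _ r)) (edge : ∀ e, motive (edgeGen e))
    (mul : ∀ x y, motive x → motive y → motive (x * y))
    (add : ∀ x y, motive x → motive y → motive (x + y)) : motive x := by
  induction x using ExteriorAlgebra.induction with
  | algebraMap r => exact scalar r
  | mul x y hx hy => exact mul x y hx hy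
  | add x y hx hy => exact add x y hx hy
  | ι m =>
    induction m using Finsupp.induction_linear with
    | zero => simpa using scalar 0
    | add a b ha hb => rw [map_add]; exact add _ _ ha hb
    | single e c =>
      have h : ExteriorAlgebra.ι ℝ (Finsupp.single e c) =
          algebraMap ℝ (LGra V) c * edgeGen e := by
        rw [← Algebra.smul_def, edgeGen, ← map_smul, Finsupp.smul_single_one]
      rw [h]
      exact mul _ _ (scalar c) (edge e)

theorem graphOp_edgeGen (e : Edge V) (a : Multi (V → Pt d)) :
    (graphOp V d (edgeGen e)).unop a = edgeOp d e.1 a := by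
  simp [graphOp, edgeGen, edgeOpLin, ExteriorAlgebra.lift_ι_apply]

theorem graphOp_algebraMap (r : ℝ) (a : Multi (V → Pt d)) :
    (graphOp V d (algebraMap ℝ _ r)).unop a = r • a := by
  simp only [AlgHom.commutes, MulOpposite.algebraMap_apply, MulOpposite.unop_op,
    Module.algebraMap_end_apply]

theorem graphOp_mul (x y : LGra V) (a : Multi (V → Pt d)) :
    (graphOp V d (x * y)).unop a = (graphOp V d y).unop ((graphOp V d x).unop a) := by
  simp only [map_mul, MulOpposite.unop_mul, Module.End.mul_apply]

theorem graphOp_add (x y : LGra V) (a : Multi (V → Pt d)) :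
    (graphOp V d (x + y)).unop a = (graphOp V d x).unop a + (graphOp V d y).unop a := by
  simp only [map_add, MulOpposite.unop_add, LinearMap.add_apply]

theorem graphOp_sum {ι : Type*} (s : Finset ι) (x : ι → LGra V) (a : Multi (V → Pt d)) :
    (graphOp V d (∑ i ∈ s, x i)).unop a = ∑ i ∈ s, (graphOp V d (x i)).unop a := by
  classical
  induction s using Finset.induction_on with
  | empty => simp
  | insert i s hi ih => rw [Finset.sum_insert hi, Finset.sum_insert hi, graphOp_add, ih]

theorem edgeOp_mk (i j : V) (a : Multi (V → Pt d)) :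
    edgeOp d s(i, j) a =
      ∑ α : Fin d, (dXiAt i α (dXAt j α a) + dXAt i α (dXiAt j α a)) := by
  simp only [edgeOp, Sym2.lift_mk, LinearMap.sum_apply, LinearMap.add_apply,
    Module.End.mul_apply]

-- The chain rule at both ends gives a sum over pairs of vertices lying over `p` and `q`. As `p ≠
-- q`, such pairs correspond one-to-one to the unordered edges over `e`.
open Classical in
theorem edgeOp_transport (π : W → V) (e : Edge V) (a : Multi (W → Pt d)) :
    edgeOp d e.1 (transport π a) =
      ∑ e' : Edge W with e'.1.map π = e.1, transport π (edgeOp d e'.1 a) := by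
  obtain ⟨e, he⟩ := e
  induction e with | _ p q
  have hpq : p ≠ q := by simpa using he
  have h1 : edgeOp d s(p, q) (transport π a) =
      ∑ w : W with π w = p, ∑ w' : W with π w' = q, transport π (edgeOp d s(w, w') a) := by
    simp only [edgeOp_mk, dXAt_transport, dXiAt_transport, map_sum, map_add,
      ← Finset.sum_add_distrib]
    rw [Finset.sum_comm, Finset.sum_comm (s := Finset.univ.filter fun w => π w = p)]
    exact Finset.sum_congr rfl fun w' _ => Finset.sum_comm
  rw [h1, ← Finset.sum_product']
  refine Finset.sum_bij (fun w hw => ⟨s(w.1, w.2), ?_⟩) ?_ ?_ ?_ ?_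
  · simp only [Finset.mem_product, Finset.mem_filter, Finset.mem_univ, true_and] at hw
    simp only [Sym2.mk_isDiag_iff]
    rintro h
    exact hpq (by rw [← hw.1, ← hw.2, h])
  · intro w hw
    simp only [Finset.mem_product, Finset.mem_filter, Finset.mem_univ, true_and] at hw ⊢
    simp [hw.1, hw.2]
  · rintro ⟨w, w'⟩ hw ⟨u, u'⟩ hu h
    simp only [Finset.mem_product, Finset.mem_filter, Finset.mem_univ, true_and] at hw hu
    rcases Sym2.eq_iff.1 (congrArg Subtype.val h) with ⟨h, h'⟩ | ⟨h, h'⟩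
    · exact Prod.ext h h'
    · exact absurd (by rw [← hw.1, ← hu.2]; exact congrArg π h) hpq
  · rintro ⟨e', hd⟩ he'
    induction e' with | _ w w'
    have he' := (Finset.mem_filter.1 he').2
    rcases Sym2.eq_iff.1 he' with ⟨h, h'⟩ | ⟨h, h'⟩
    · exact ⟨(w, w'), by simp [h, h'], rfl⟩
    · exact ⟨(w', w), by simp [h, h'], Subtype.ext Sym2.eq_swap⟩
  · intros
    rfl

/-- Both sides respect products of graphs, so the case of a single edge suffices. -/
theorem graphOp_transport (π : W → V) (x : LGra V) (a : Multi (W → Pt d)) :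
    (graphOp V d x).unop (transport π a) =
      transport π ((graphOp W d (redirect π x)).unop a) := by
  classical
  induction x using lgra_induction generalizing a with
  | scalar r =>
    rw [(redirect π).commutes, graphOp_algebraMap, graphOp_algebraMap, map_smul]
  | edge e =>
    rw [graphOp_edgeGen, edgeOp_transport, redirect_edgeGen, graphOp_sum, map_sum]
    simp only [graphOp_edgeGen]
    congr!
  | mul x y hx hy => rw [map_mul (redirect π), graphOp_mul, graphOp_mul, hx, hy]
  | add x y hx hy => rw [map_add (redirect π), graphOp_add, graphOp_add, hx, hy, map_add]

/-- The superfunction does not depend on the variables in the vertices in the image of `f`. -/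
def IndependentOf (f : V ↪ W) (b : Multi (W → Pt d)) : Prop :=
  ∀ v α, dXAt (f v) α b = 0 ∧ dXiAt (f v) α b = 0

theorem independentOf_one (f : V ↪ W) : IndependentOf f (1 : Multi (W → Pt d)) :=
  fun _ _ => ⟨dX_one _, dXi_one _⟩

theorem IndependentOf.mul {f : V ↪ W} {a b : Multi (W → Pt d)} (ha : IndependentOf f a)
    (hb : IndependentOf f b) : IndependentOf f (a * b) := fun v α => by
  have h1 : dXAt (f v) α (a * b) = dXAt (f v) α a * b + a * dXAt (f v) α b := dX_mul _ _ _
  have h2 : dXiAt (f v) α (a * b) = dXiAt (f v) α a * b + gradeInv _ a * dXiAt (f v) α b :=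
    dXi_mul _ _ _
  rw [h1, h2, (ha v α).1, (ha v α).2, (hb v α).1, (hb v α).2]
  simp

theorem independentOf_place (f : V ↪ W) {w : W} (h : ∀ v, f v ≠ w) (p : Multi (Pt d)) :
    IndependentOf f (place w p) :=
  fun v α => ⟨dXAt_place_of_ne (h v) α p, dXiAt_place_of_ne (h v) α p⟩

theorem dXAt_transport_mul (f : V ↪ W) (v : V) (α : Fin d) (a : Multi (V → Pt d))
    {b : Multi (W → Pt d)} (hb : IndependentOf f b) :
    dXAt (f v) α (transport f a * b) = transport f (dXAt v α a) * b := by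
  have h1 : dXAt (f v) α (transport f a * b) =
    dXAt (f v) α (transport f a) * b + transport f a * dXAt (f v) α b := dX_mul _ _ _
  rw [h1, (hb v α).1, mul_zero, add_zero, dXAt_transport, Finset.sum_eq_single v]
  · intro u hu huv
    exact absurd (f.injective (Finset.mem_filter.1 hu).2) huv
  · exact fun h => absurd (by
      rw [Finset.mem_filter]
      exact ⟨Finset.mem_univ v, rfl⟩) h

theorem dXiAt_transport_mul (f : V ↪ W) (v : V) (α : Fin d) (a : Multi (V → Pt d))
    {b : Multi (W → Pt d)} (hb : IndependentOf f b) :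
    dXiAt (f v) α (transport f a * b) = transport f (dXiAt v α a) * b := by
  have h1 : dXiAt (f v) α (transport f a * b) =
    dXiAt (f v) α (transport f a) * b + gradeInv _ (transport f a) * dXiAt (f v) α b :=
      dXi_mul _ _ _
  rw [h1, (hb v α).2, mul_zero, add_zero, dXiAt_transport, Finset.sum_eq_single v]
  · intro u hu huv
    exact absurd (f.injective (Finset.mem_filter.1 hu).2) huv
  · exact fun h => absurd (by
      rw [Finset.mem_filter]
      exact ⟨Finset.mem_univ v, rfl⟩) h

theorem edgeOp_map_transport_mul (f : V ↪ W) (e : Sym2 V) (a : Multi (V → Pt d))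
    {b : Multi (W → Pt d)} (hb : IndependentOf f b) :
    edgeOp d (e.map f) (transport f a * b) = transport f (edgeOp d e a) * b := by
  induction e with | _ i j
  rw [Sym2.map_mk, edgeOp_mk, edgeOp_mk, map_sum, Finset.sum_mul]
  refine Finset.sum_congr rfl fun α _ => ?_
  rw [dXAt_transport_mul f j α a hb, dXiAt_transport_mul f j α a hb,
    dXiAt_transport_mul f i α _ hb, dXAt_transport_mul f i α _ hb, map_add, add_mul]

/-- The factor `b` is constant for all the derivatives involved. It stands on the right, so the only
signed term of the odd Leibniz rule contains a derivative of `b` and vanishes. -/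
theorem graphOp_push_transport_mul (f : V ↪ W) (x : LGra V) (a : Multi (V → Pt d))
    {b : Multi (W → Pt d)} (hb : IndependentOf f b) :
    (graphOp W d (push f x)).unop (transport f a * b) =
      transport f ((graphOp V d x).unop a) * b := by
  induction x using lgra_induction generalizing a with
  | scalar r =>
    rw [(push f).commutes, graphOp_algebraMap, graphOp_algebraMap, map_smul, smul_mul_assoc]
  | edge e =>
    rw [push_edgeGen, graphOp_edgeGen, graphOp_edgeGen, Edge.map_val,
      edgeOp_map_transport_mul f e.1 a hb]
  | mul x y hx hy => rw [map_mul (push f), graphOp_mul, graphOp_mul, hx, hy]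
  | add x y hx hy => rw [map_add (push f), graphOp_add, graphOp_add, hx, hy, map_add, add_mul]

/-! ## Evaluation of graphs at even multivectors -/

/-- The even multivector `p` placed in the vertex `v`. -/
def placeEven (v : V) : evenMulti (Pt d) →ₐ[ℝ] evenMulti (V → Pt d) :=
  ((place v).comp (evenMulti (Pt d)).val).codRestrict _ fun p => subst_mem_evenMulti _ _ p.2

theorem coe_placeEven (v : V) (p : evenMulti (Pt d)) :
    (placeEven v p : Multi (V → Pt d)) = place v (p : Multi (Pt d)) := rfl

/-- Transport of even superfunctions. -/
def transportEven (g : V → W) : evenMulti (V → Pt d) →ₐ[ℝ] evenMulti (W → Pt d) :=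
  ((transport g).comp (evenMulti (V → Pt d)).val).codRestrict _
    fun a => subst_mem_evenMulti _ _ a.2

theorem coe_transportEven (g : V → W) (a : evenMulti (V → Pt d)) :
    (transportEven g a : Multi (W → Pt d)) = transport g (a : Multi (V → Pt d)) := rfl

theorem transportEven_placeEven (g : V → W) (v : V) (p : evenMulti (Pt d)) :
    transportEven g (placeEven v p) = placeEven (g v) p :=
  Subtype.ext (transport_place g v (p : Multi (Pt d)))

/-- The value of the operator of a graph at even multivectors placed in its vertices. -/
def evalGraph (V : Type) [Fintype V] [DecidableEq V] (x : LGra V) (a : Multi (V → Pt d)) :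
    Multi (Pt d) :=
  diagonal V d ((graphOp V d x).unop a)

/-- The product of copies of `p` in all the vertices. -/
def placeAll (V : Type) [Fintype V] [DecidableEq V] (p : evenMulti (Pt d)) :
    evenMulti (V → Pt d) := ∏ v, placeEven v p

theorem evalGraph_push_equiv (g : V ≃ W) (x : LGra V) (p : evenMulti (Pt d)) :
    evalGraph W (push g.toEmbedding x) (placeAll W p : Multi (W → Pt d)) =
      evalGraph V x (placeAll V p : Multi (V → Pt d)) := by
  have h : (placeAll W p : Multi (W → Pt d)) =
      transport g.toEmbedding (placeAll V p : Multi (V → Pt d)) * 1 := by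
    rw [mul_one, ← coe_transportEven, placeAll, placeAll, map_prod, ← Equiv.prod_comp g]
    simp only [transportEven_placeEven]
    rfl
  rw [evalGraph, h, graphOp_push_transport_mul _ _ _ (independentOf_one _), mul_one,
    diagonal_transport]
  rfl

/-- Even factors commute, so every permutation gives the same product and the `n!` equal terms
cancel the prefactor. -/
theorem orientLab_const (n : ℕ) (p : evenMulti (Pt d)) (x : LGra (Fin n)) :
    orientLab n d (fun _ => (p : Multi (Pt d))) x =
      evalGraph (Fin n) x (placeAll (Fin n) p : Multi (Fin n → Pt d)) := by
  have h : ∀ σ : Equiv.Perm (Fin n),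
      (List.ofFn fun i => place (V := Fin n) (σ i) (p : Multi (Pt d))).prod =
        (placeAll (Fin n) p : Multi (Fin n → Pt d)) := by
    intro σ
    rw [placeAll, ← Equiv.prod_comp σ, ← List.prod_ofFn]
    have h := map_list_prod (evenMulti (Fin n → Pt d)).val (List.ofFn fun i => placeEven (σ i) p)
    rw [List.map_ofFn] at h
    exact h.symm
  simp only [orientLab_apply, h, Finset.sum_const, Finset.card_univ, Fintype.card_perm,
    Fintype.card_fin]
  rw [← Nat.cast_smul_eq_nsmul ℝ, smul_smul, inv_mul_cancel₀ (by positivity), one_smul]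
  rfl

theorem OrMap_unlabel (x : LGra V) (p : evenMulti (Pt d)) :
    OrMap (p : Multi (Pt d)) (unlabel V x) =
      evalGraph V x (placeAll V p : Multi (V → Pt d)) := by
  rw [unlabel_eq (Fintype.equivFin V), OrMap, DirectSum.toModule_lof, orient,
    Representation.Coinvariants.lift_mk, orientLab_const, evalGraph_push_equiv]

/-- The product of copies of `p` in all the vertices except `v`. -/
def placeOthers (v : V) (p : evenMulti (Pt d)) : evenMulti (V → Pt d) :=
  ∏ w : {w : V // w ≠ v}, placeEven w.1 p

/-- The value of a graph when the multivector `q` is placed in the vertex `v` and copies of `p`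
are placed in the other vertices. -/
def evalAt (v : V) (y : LGra V) (p : evenMulti (Pt d)) :
    Multi (Pt d) →ₗ[ℝ] Multi (Pt d) :=
  (diagonal V d).toLinearMap ∘ₗ (graphOp V d y).unop ∘ₗ
    (LinearMap.mulRight ℝ (placeOthers v p : Multi (V → Pt d))) ∘ₗ (place v).toLinearMap

theorem evalAt_apply (v : V) (y : LGra V) (p : evenMulti (Pt d)) (q : Multi (Pt d)) :
    evalAt v y p q = evalGraph V y (place v q * (placeOthers v p : Multi (V → Pt d))) := rfl

/-- The edges of `x` act first and see only the copies of `p` in the vertices of `V`. Restriction to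
the final diagonal factors through `collapse`, and moving the operator of `y` across this
identification replaces its redirected edges by the original ones. -/
theorem evalGraph_insertAt (v : W) (x : LGra V) (y : LGra W) (p : evenMulti (Pt d)) :
    evalGraph (Blow V W v) (insertAt v x y) (placeAll (Blow V W v) p : Multi (Blow V W v → Pt d)) =
      evalAt v y p (evalGraph V x (placeAll V p : Multi (V → Pt d))) := by
  -- The copies of `p` in the untouched vertices of the host, independent of the variables of the
  -- inserted graph.
  set b : evenMulti (Blow V W v → Pt d) := ∏ w : {w : W // w ≠ v}, placeEven (Sum.inr w) p
    with hb_def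
  have hb : IndependentOf (Function.Embedding.inl : V ↪ Blow V W v)
      (b : Multi (Blow V W v → Pt d)) := by
    refine Finset.prod_induction _ (fun b : evenMulti (Blow V W v → Pt d) =>
      IndependentOf (Function.Embedding.inl : V ↪ Blow V W v) (b : Multi (Blow V W v → Pt d)))
      (fun _ _ => IndependentOf.mul) (independentOf_one _) fun w _ => ?_
    exact independentOf_place _ (fun _ => Sum.inl_ne_inr) _
  have hall : (placeAll (Blow V W v) p : Multi (Blow V W v → Pt d)) =
      transport (Function.Embedding.inl : V ↪ Blow V W v)
        (placeAll V p : Multi (V → Pt d)) * b := by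
    rw [← coe_transportEven, placeAll, placeAll, map_prod, Fintype.prod_sum_type]
    simp only [transportEven_placeEven]
    rfl
  have hbv : transport (collapse V v) (b : Multi (Blow V W v → Pt d)) =
      (placeOthers v p : Multi (W → Pt d)) := by
    rw [← coe_transportEven, hb_def, map_prod]
    simp only [transportEven_placeEven]
    rfl
  rw [evalAt_apply, evalGraph, insertAt_apply, graphOp_mul, hall,
    graphOp_push_transport_mul _ _ _ hb, ← diagonal_transport (collapse V v),
    ← graphOp_transport, map_mul, transport_transport, hbv]
  have hc : collapse V v ∘ (Function.Embedding.inl : V ↪ Blow V W v) = fun _ => v := rfl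
  rw [hc, transport_const]
  rfl

/-- The inserted graph enters only through its value at `p`, and linearly. -/
theorem OrMap_ins_unlabel (γ : Gra) (y : LGra W) (p : evenMulti (Pt d)) :
    OrMap (p : Multi (Pt d)) (ins γ (unlabel W y)) =
      ∑ v, evalAt v y p (OrMap (p : Multi (Pt d)) γ) := by
  induction γ using gra_induction with
  | zero => simp
  | add a b ha hb => simp only [map_add, LinearMap.add_apply, ha, hb, Finset.sum_add_distrib]
  | unlabel n x =>
    rw [ins_unlabel, map_sum]
    simp only [OrMap_unlabel, evalGraph_insertAt]

theorem OrMap_ins_eq_zero {γ : Gra} {p : evenMulti (Pt d)}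
    (h : OrMap (p : Multi (Pt d)) γ = 0) (γ' : Gra) :
    OrMap (p : Multi (Pt d)) (ins γ γ') = 0 := by
  induction γ' using gra_induction with
  | zero => simp
  | add a b ha hb => simp only [map_add, ha, hb, add_zero]
  | unlabel n y => simp [OrMap_ins_unlabel, h]

end GraphOp

/-! ## The velocity of the flow of a graph -/

section Velocity

variable {V : Type} [Fintype V] [DecidableEq V] {d : ℕ}

/-- The algebra `R` carries no topology; applying `l` to the coefficients turns the expression into
a real polynomial in the parameter. -/
theorem hasDerivAt_eval_algebraMap {R : Type*} [CommRing R] [Algebra ℝ R] (l : R →ₗ[ℝ] ℝ)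
    (p : Polynomial R) (t : ℝ) :
    HasDerivAt (fun ε : ℝ => l (p.eval (algebraMap ℝ R ε)))
      (l (p.derivative.eval (algebraMap ℝ R t))) t := by
  induction p using Polynomial.induction_on' with
  | add p q hp hq => simpa using hp.fun_add hq
  | monomial n a =>
    have h1 : ∀ (r : ℝ) (m : ℕ) (b : R), l (b * algebraMap ℝ R r ^ m) = r ^ m * l b := by
      intro r m b
      rw [← map_pow, mul_comm, ← Algebra.smul_def, map_smul, smul_eq_mul]
    have h2 : l (a * (n : R)) = n * l a := by
      rw [mul_comm, ← nsmul_eq_mul, map_nsmul, nsmul_eq_mul]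
    simp only [Polynomial.derivative_monomial, Polynomial.eval_monomial, h1, h2]
    exact ((hasDerivAt_pow n t).mul_const (l a)).congr_deriv (by ring)

theorem hasDerivAt_prod_add_smul {R ι : Type*} [CommRing R] [Algebra ℝ R] [Fintype ι]
    [DecidableEq ι] (l : R →ₗ[ℝ] ℝ) (a b : ι → R) :
    HasDerivAt (fun ε : ℝ => l (∏ i, (a i + ε • b i)))
      (l (∑ i, (∏ j ∈ Finset.univ.erase i, a j) * b i)) 0 := by
  -- The product is the value at $\varepsilon$ of $\prod_i(a_i+Xb_i)$, whose formal derivative at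
  -- zero is the Leibniz sum.
  have h := hasDerivAt_eval_algebraMap l
    (∏ i, (Polynomial.C (a i) + Polynomial.X * Polynomial.C (b i))) 0
  simp only [Polynomial.derivative_prod_finset, Polynomial.eval_prod, Polynomial.eval_finsetSum,
    Polynomial.eval_mul, Polynomial.eval_add, Polynomial.eval_C, Polynomial.eval_X,
    Polynomial.derivative_add, Polynomial.derivative_C, Polynomial.derivative_mul,
    Polynomial.derivative_X, map_zero, zero_mul, add_zero, zero_add, one_mul, mul_zero,
    ← Algebra.smul_def] at h
  exact h

theorem placeOthers_eq_prod_erase (v : V) (p : evenMulti (Pt d)) :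
    placeOthers v p = ∏ w ∈ Finset.univ.erase v, placeEven w p :=
  (Finset.prod_subtype (p := fun w => w ≠ v) (Finset.univ.erase v) (by simp)
    fun w => placeEven w p).symm

theorem hasVelocity_OrMap_unlabel (y : LGra V) (p q : evenMulti (Pt d)) :
    HasVelocity (fun P' => OrMap P' (unlabel V y)) (p : Multi (Pt d)) (q : Multi (Pt d))
      (∑ v, evalAt v y p (q : Multi (Pt d))) := by
  intro x φ
  set l : evenMulti (V → Pt d) →ₗ[ℝ] ℝ := component x φ ∘ₗ (diagonal V d).toLinearMap ∘ₗ
    (graphOp V d y).unop ∘ₗ (evenMulti (V → Pt d)).val.toLinearMap with hl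
  have h := hasDerivAt_prod_add_smul l (fun v => placeEven v p) (fun v => placeEven v q)
  have h1 : ∀ ε : ℝ, l (∏ v, (placeEven v p + ε • placeEven v q)) =
      -- The whole line through `p` in the direction `q` consists of even superfunctions, so the
      -- unordered formula for `OrMap` applies at every `ε`.
      component x φ (OrMap ((p : Multi (Pt d)) + ε • (q : Multi (Pt d))) (unlabel V y)) := by
    intro ε
    have := OrMap_unlabel y (p + ε • q)
    rw [Subalgebra.coe_add, Subalgebra.coe_smul] at this
    rw [this, placeAll]
    simp only [map_add, map_smul]
    rfl
  have h2 : l (∑ v, (∏ w ∈ Finset.univ.erase v, placeEven w p) * placeEven v q) =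
      component x φ (∑ v, evalAt v y p (q : Multi (Pt d))) := by
    rw [map_sum, map_sum]
    refine Finset.sum_congr rfl fun v _ => ?_
    rw [← placeOthers_eq_prod_erase, mul_comm]
    rfl
  rw [h2] at h
  simp only [h1] at h
  exact h

/-- Differentiating the product of copies of $P$ replaces one copy at a time by `OrMap p γ₁`, and
this is the sum over vertices that defines insertion. -/
theorem hasVelocity_OrMap (γ₁ γ₂ : Gra) (p : evenMulti (Pt d))
    (h : OrMap (p : Multi (Pt d)) γ₁ ∈ evenMulti (Pt d)) :
    HasVelocity (fun P' => OrMap P' γ₂) (p : Multi (Pt d)) (OrMap (p : Multi (Pt d)) γ₁)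
      (OrMap (p : Multi (Pt d)) (ins γ₁ γ₂)) := by
  induction γ₂ using gra_induction with
  | zero =>
    intro x φ
    simpa using hasDerivAt_const (0 : ℝ) (0 : ℝ)
  | add a b ha hb =>
    intro x φ
    simpa using (ha x φ).fun_add (hb x φ)
  | unlabel n y =>
    rw [OrMap_ins_unlabel]
    exact hasVelocity_OrMap_unlabel y p ⟨_, h⟩

end Velocity

/-! ## Degrees of multivectors -/

section Degree

variable {E F : Type} [NormedAddCommGroup E] [NormedSpace ℝ E] [NormedAddCommGroup F]
  [NormedSpace ℝ F]

/-- The multivector fields of degree `k`. -/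
def multivectors (E : Type) [NormedAddCommGroup E] [NormedSpace ℝ E] (k : ℕ) :
    Submodule ℝ (Multi E) :=
  Submodule.span ℝ {z | ∃ f : Smooth E, ∃ w ∈ ⋀[ℝ]^k E, z = f ⊗ₜ[ℝ] w}

theorem tmul_mem_multivectors (f : Smooth E) {k : ℕ} {w : ExteriorAlgebra ℝ E}
    (hw : w ∈ ⋀[ℝ]^k E) : f ⊗ₜ[ℝ] w ∈ multivectors E k :=
  Submodule.subset_span ⟨f, w, hw, rfl⟩

theorem multivectors_two : multivectors E 2 = bivectors E := by
  apply le_antisymm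
  · refine Submodule.span_le.2 ?_
    rintro _ ⟨f, w, hw, rfl⟩
    exact ⟨f ⊗ₜ ⟨w, hw⟩, rfl⟩
  · rintro _ ⟨t, rfl⟩
    induction t using TensorProduct.induction_on with
    | zero => simp
    | add a b ha hb => rw [map_add]; exact add_mem ha hb
    | tmul f w => exact tmul_mem_multivectors f w.2

theorem exteriorPower_two_le_evenAlg : ⋀[ℝ]^2 E ≤ Subalgebra.toSubmodule (evenAlg E) := by
  rw [ExteriorAlgebra.exteriorPower, pow_two, Submodule.mul_le]
  rintro _ ⟨a, rfl⟩ _ ⟨b, rfl⟩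
  exact ι_mul_ι_mem_evenAlg a b

theorem bivectors_le_evenMulti : bivectors E ≤ Subalgebra.toSubmodule (evenMulti E) := by
  rw [← multivectors_two]
  refine Submodule.span_le.2 ?_
  rintro _ ⟨f, w, hw, rfl⟩
  exact tmul_mem_evenMulti f (exteriorPower_two_le_evenAlg hw)

theorem one_mem_multivectors : (1 : Multi E) ∈ multivectors E 0 :=
  tmul_mem_multivectors 1 (by rw [ExteriorAlgebra.exteriorPower, pow_zero]; exact Submodule.one_le.1 le_rfl)

theorem mul_mem_multivectors {j k : ℕ} {a b : Multi E} (ha : a ∈ multivectors E j)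
    (hb : b ∈ multivectors E k) : a * b ∈ multivectors E (j + k) := by
  induction ha using Submodule.span_induction with
  | zero => rw [zero_mul]; exact zero_mem _
  | add a a' _ _ ha ha' => rw [add_mul]; exact add_mem ha ha'
  | smul c a _ ha => rw [smul_mul_assoc]; exact Submodule.smul_mem _ c ha
  | mem a ha =>
    obtain ⟨f, w, hw, rfl⟩ := ha
    induction hb using Submodule.span_induction with
    | zero => rw [mul_zero]; exact zero_mem _
    | add a a' _ _ ha ha' => rw [mul_add]; exact add_mem ha ha'
    | smul c a _ ha => rw [mul_smul_comm]; exact Submodule.smul_mem _ c ha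
    | mem b hb =>
      obtain ⟨g, u, hu, rfl⟩ := hb
      rw [Algebra.TensorProduct.tmul_mul_tmul]
      refine tmul_mem_multivectors _ ?_
      rw [ExteriorAlgebra.exteriorPower, pow_add]
      exact Submodule.mul_mem_mul hw hu

theorem subst_mem_multivectors (L : E →L[ℝ] F) (M : F →ₗ[ℝ] E) {k : ℕ} {a : Multi F}
    (ha : a ∈ multivectors F k) : subst L M a ∈ multivectors E k := by
  have h : multivectors F k ≤ (multivectors E k).comap (subst L M).toLinearMap := by
    refine Submodule.span_le.2 ?_
    rintro _ ⟨f, w, hw, rfl⟩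
    refine tmul_mem_multivectors _ ?_
    have hw : ExteriorAlgebra.map M w ∈
        (⋀[ℝ]^k F).map (ExteriorAlgebra.map M).toLinearMap := ⟨w, hw, rfl⟩
    rw [ExteriorAlgebra.exteriorPower, Submodule.map_pow] at hw
    have hle : (LinearMap.range (ExteriorAlgebra.ι ℝ : F →ₗ[ℝ] ExteriorAlgebra ℝ F)).map
        (ExteriorAlgebra.map M).toLinearMap ≤ LinearMap.range (ExteriorAlgebra.ι ℝ) := by
      rintro _ ⟨_, ⟨m, rfl⟩, rfl⟩
      exact ⟨M m, (ExteriorAlgebra.map_apply_ι M m).symm⟩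
    exact (pow_le_pow_left' hle k) hw
  exact h ha

theorem dX_mem_multivectors (v : E) {k : ℕ} {a : Multi E} (ha : a ∈ multivectors E k) :
    dX v a ∈ multivectors E k := by
  have h : multivectors E k ≤ (multivectors E k).comap (dX v) := by
    refine Submodule.span_le.2 ?_
    rintro _ ⟨f, w, hw, rfl⟩
    exact tmul_mem_multivectors _ hw
  exact h ha

theorem contractLeft_mem_exteriorPower (φ : Module.Dual ℝ E) {k : ℕ} {w : ExteriorAlgebra ℝ E}
    (hw : w ∈ ⋀[ℝ]^(k + 1) E) :
    CliffordAlgebra.contractLeft (Q := (0 : QuadraticForm ℝ E)) φ w ∈ ⋀[ℝ]^k E := by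
  induction k generalizing w with
  | zero =>
    rw [ExteriorAlgebra.exteriorPower, zero_add, pow_one] at hw
    obtain ⟨m, rfl⟩ := hw
    have h := CliffordAlgebra.contractLeft_ι (Q := (0 : QuadraticForm ℝ E)) φ m
    change CliffordAlgebra.contractLeft φ (CliffordAlgebra.ι (0 : QuadraticForm ℝ E) m) ∈ _
    rw [h, ExteriorAlgebra.exteriorPower, pow_zero]
    exact Submodule.algebraMap_mem _
  | succ k ih =>
    rw [ExteriorAlgebra.exteriorPower, pow_succ'] at hw
    refine Submodule.mul_induction_on hw ?_ fun a b ha hb => ?_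
    · rintro _ ⟨m, rfl⟩ w hw
      have h := CliffordAlgebra.contractLeft_ι_mul (Q := (0 : QuadraticForm ℝ E)) (d := φ) m w
      change CliffordAlgebra.contractLeft φ (CliffordAlgebra.ι (0 : QuadraticForm ℝ E) m * w) ∈ _
      rw [h]
      refine sub_mem (Submodule.smul_mem _ _ hw) ?_
      rw [ExteriorAlgebra.exteriorPower, pow_succ']
      exact Submodule.mul_mem_mul ⟨m, rfl⟩ (ih hw)
    · rw [map_add]
      exact add_mem ha hb

theorem dXi_mem_multivectors (φ : Module.Dual ℝ E) {k : ℕ} {a : Multi E}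
    (ha : a ∈ multivectors E (k + 1)) : dXi φ a ∈ multivectors E k := by
  have h : multivectors E (k + 1) ≤ (multivectors E k).comap (dXi φ) := by
    refine Submodule.span_le.2 ?_
    rintro _ ⟨f, w, hw, rfl⟩
    exact tmul_mem_multivectors _ (contractLeft_mem_exteriorPower φ hw)
  exact h ha

/-- On $m\wedge n$ the left contraction is $\varphi(m)n-\varphi(n)m$ and the right one is
$\varphi(n)m-\varphi(m)n$. The resulting sign reconciles the right derivatives of the Schouten
bracket with the left derivatives of the edge operators. -/
theorem contractRight_exteriorPower_two (φ : Module.Dual ℝ E) {w : ExteriorAlgebra ℝ E}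
    (hw : w ∈ ⋀[ℝ]^2 E) :
    (CliffordAlgebra.contractRight (Q := (0 : QuadraticForm ℝ E))).flip φ w =
      -CliffordAlgebra.contractLeft (Q := (0 : QuadraticForm ℝ E)) φ w := by
  rw [ExteriorAlgebra.exteriorPower, pow_two] at hw
  refine Submodule.mul_induction_on hw ?_ fun a b ha hb => ?_
  · rintro _ ⟨m, rfl⟩ _ ⟨n, rfl⟩
    rw [LinearMap.flip_apply]
    change CliffordAlgebra.contractRight (CliffordAlgebra.ι (0 : QuadraticForm ℝ E) m *
      CliffordAlgebra.ι _ n) φ = -CliffordAlgebra.contractLeft φ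
        (CliffordAlgebra.ι (0 : QuadraticForm ℝ E) m * CliffordAlgebra.ι _ n)
    rw [CliffordAlgebra.contractRight_mul_ι, CliffordAlgebra.contractLeft_ι_mul,
      CliffordAlgebra.contractLeft_ι, CliffordAlgebra.contractRight_ι, neg_sub,
      Algebra.smul_def, Algebra.smul_def, Algebra.commutes]
  · rw [map_add, map_add, ha, hb, neg_add]

theorem dXiRight_of_mem_bivectors (φ : Module.Dual ℝ E) {a : Multi E} (ha : a ∈ bivectors E) :
    dXiRight φ a = -dXi φ a := by
  rw [← multivectors_two] at ha
  induction ha using Submodule.span_induction with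
  | zero => rw [map_zero, map_zero, neg_zero]
  | add a b _ _ ha hb => rw [map_add, map_add, ha, hb, neg_add]
  | smul c a _ ha => rw [map_smul, map_smul, ha, smul_neg]
  | mem a ha =>
    obtain ⟨f, w, hw, rfl⟩ := ha
    simp only [dXi, dXiRight, LinearMap.lTensor_tmul, contractRight_exteriorPower_two φ hw,
      TensorProduct.tmul_neg]

end Degree

/-! ### Degrees of the values of graphs. -/

section GraphDegree

variable {V : Type} [Fintype V] [DecidableEq V] {d : ℕ}

theorem edgeOp_mem_multivectors (e : Sym2 V) {k : ℕ} {a : Multi (V → Pt d)}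
    (ha : a ∈ multivectors (V → Pt d) (k + 1)) : edgeOp d e a ∈ multivectors (V → Pt d) k := by
  induction e with | _ i j
  rw [edgeOp_mk]
  exact sum_mem fun α _ => add_mem (dXi_mem_multivectors _ (dX_mem_multivectors _ ha))
    (dX_mem_multivectors _ (dXi_mem_multivectors _ ha))

theorem graphOp_list_prod_mem_multivectors (l : List (Edge V)) {k : ℕ} {a : Multi (V → Pt d)}
    (ha : a ∈ multivectors (V → Pt d) (k + l.length)) :
    (graphOp V d (l.map edgeGen).prod).unop a ∈ multivectors (V → Pt d) k := by
  induction l generalizing a with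
  | nil => simpa using ha
  | cons e l ih =>
    rw [List.map_cons, List.prod_cons, graphOp_mul, graphOp_edgeGen]
    exact ih (edgeOp_mem_multivectors _ ha)

theorem prod_placeEven_mem_multivectors (s : Finset V) {k : ℕ} {p : evenMulti (Pt d)}
    (hp : (p : Multi (Pt d)) ∈ multivectors (Pt d) k) :
    ((∏ v ∈ s, placeEven v p : evenMulti (V → Pt d)) : Multi (V → Pt d)) ∈
      multivectors (V → Pt d) (s.card * k) := by
  induction s using Finset.induction_on with
  | empty =>
    rw [Finset.prod_empty, Finset.card_empty, zero_mul]
    exact one_mem_multivectors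
  | insert v s hv ih =>
    rw [Finset.prod_insert hv, Finset.card_insert_of_notMem hv, add_mul, one_mul, add_comm]
    exact mul_mem_multivectors (subst_mem_multivectors _ _ hp) ih

/-- The `k + 1` bi-vectors have total degree `2 * (k + 1)`, and each of the `2 * k` edges lowers it
by one, leaving two. -/
theorem OrMap_mem_bivectors {p : evenMulti (Pt d)} (hp : (p : Multi (Pt d)) ∈ bivectors (Pt d))
    {γ : Gra} (hγ : γ ∈ ⨆ k : ℕ, homogeneous (k + 1) (2 * k)) :
    OrMap (p : Multi (Pt d)) γ ∈ bivectors (Pt d) := by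
  have h : (⨆ k : ℕ, homogeneous (k + 1) (2 * k)) ≤
      (bivectors (Pt d)).comap (OrMap (p : Multi (Pt d))) := by
    refine iSup_le fun k => Submodule.span_le.2 ?_
    rintro _ ⟨l, hl, -, -, rfl⟩
    change OrMap (p : Multi (Pt d)) (graph (k + 1) l) ∈ bivectors (Pt d)
    rw [graph, OrMap_unlabel, ← multivectors_two]
    refine subst_mem_multivectors _ _ (graphOp_list_prod_mem_multivectors l ?_)
    rw [← multivectors_two] at hp
    have := prod_placeEven_mem_multivectors (Finset.univ : Finset (Fin (k + 1))) hp
    rwa [Finset.card_univ, Fintype.card_fin, show (k + 1) * 2 = 2 + l.length by omega] at this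
  exact h hγ

/-! ## The graph with one edge and the Schouten bracket -/

theorem dXAt_place_self (v : V) (α : Fin d) (a : Multi (Pt d)) :
    dXAt v α (place v a) = place v (dX (Pi.single α 1) a) := by
  rw [dXAt, place, dX_subst]
  simp

theorem dXiAt_place_self (v : V) (α : Fin d) (a : Multi (Pt d)) :
    dXiAt v α (place v a) = place v (dXi (LinearMap.proj α) a) := by
  rw [dXiAt, place, dXi_subst]
  congr 3
  apply LinearMap.ext
  intro p
  simp

theorem diagonal_place (v : V) (a : Multi (Pt d)) : diagonal V d (place v a) = a := by
  have h : (∑ v : V, LinearMap.proj (R := ℝ) (φ := fun _ : V => Pt d) v) ∘ₗ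
      LinearMap.single ℝ (fun _ : V => Pt d) v = LinearMap.id := by
    apply LinearMap.ext
    intro p
    simp
  rw [diagonal, place, subst_subst, h, subst, ExteriorAlgebra.map_id]
  exact DFunLike.congr_fun Algebra.TensorProduct.map_id a

/-- Since `a` is even, the odd derivative passes it without a sign. The overall minus comes from the
right derivative of `a` being minus the left one. -/
theorem diagonal_edgeOp_place {i j : V} (hij : i ≠ j) {a b : Multi (Pt d)}
    (ha : a ∈ bivectors (Pt d)) :
    diagonal V d (edgeOp d s(i, j) (place i a * place j b)) = -schouten a b := by
  have hX : ∀ (v : V) (α : Fin d) (a b : Multi (V → Pt d)),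
      dXAt v α (a * b) = dXAt v α a * b + a * dXAt v α b := fun v α => dX_mul _
  have hXi : ∀ (v : V) (α : Fin d) (a b : Multi (V → Pt d)),
      dXiAt v α (a * b) = dXiAt v α a * b + gradeInv _ a * dXiAt v α b := fun v α => dXi_mul _
  have hg : gradeInv _ (place i a) = place i a :=
    gradeInv_eq_self (subst_mem_evenMulti _ _ (bivectors_le_evenMulti ha))
  rw [edgeOp_mk, schouten, map_sum, ← Finset.sum_neg_distrib]
  refine Finset.sum_congr rfl fun α _ => ?_
  rw [hX j, dXAt_place_of_ne hij.symm, zero_mul, zero_add, hXi i, dXAt_place_self,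
    dXiAt_place_of_ne hij, mul_zero, add_zero, dXiAt_place_self, hXi j,
    dXiAt_place_of_ne hij.symm, zero_mul, zero_add, hg, dXiAt_place_self, hX i,
    dXAt_place_of_ne hij, mul_zero, add_zero, dXAt_place_self, map_add, map_mul, map_mul,
    diagonal_place, diagonal_place, diagonal_place, diagonal_place,
    dXiRight_of_mem_bivectors _ ha, neg_mul, neg_sub, sub_neg_eq_add, add_comm]

theorem stick_eq : stick = unlabel (Fin 2) (edgeGen ⟨s(0, 1), by simp⟩) := by
  simp [stick, graph]

theorem OrMap_stick {p : evenMulti (Pt d)} (hp : (p : Multi (Pt d)) ∈ bivectors (Pt d)) :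
    OrMap (p : Multi (Pt d)) stick = -schouten (p : Multi (Pt d)) p := by
  rw [stick_eq, OrMap_unlabel, evalGraph, graphOp_edgeGen, placeAll, Fin.prod_univ_two,
    Subalgebra.coe_mul, coe_placeEven, coe_placeEven]
  exact diagonal_edgeOp_place (by simp) hp

/-- The two ends of the stick contribute equally, whence the factor two. -/
theorem OrMap_ins_stick {p : evenMulti (Pt d)} (hp : (p : Multi (Pt d)) ∈ bivectors (Pt d))
    (γ : Gra) :
    OrMap (p : Multi (Pt d)) (ins γ stick) =
      (-2 : ℝ) • schouten (p : Multi (Pt d)) (OrMap (p : Multi (Pt d)) γ) := by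
  have key : ∀ (i j : Fin 2) (q : Multi (Pt d)), i ≠ j →
      placeOthers i p = placeEven j p →
      evalAt i (edgeGen ⟨s(0, 1), by simp⟩) p q = -schouten (p : Multi (Pt d)) q := by
    intro i j q hij h
    have hs : ∀ i j : Fin 2, i ≠ j → s((0 : Fin 2), 1) = s(j, i) := by decide
    -- The even `p` is commuted to the front; as the edge is unoriented, its ends may be listed with
    -- the vertex of `p` first.
    rw [evalAt_apply, evalGraph, graphOp_edgeGen, h, ← evenMulti_comm (placeEven j p).2,
      coe_placeEven]
    have := diagonal_edgeOp_place (b := q) hij.symm hp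
    rwa [← hs i j hij] at this
  have h0 : placeOthers (0 : Fin 2) p = placeEven 1 p := by
    rw [placeOthers_eq_prod_erase, show Finset.univ.erase (0 : Fin 2) = {1} by decide,
      Finset.prod_singleton]
  have h1 : placeOthers (1 : Fin 2) p = placeEven 0 p := by
    rw [placeOthers_eq_prod_erase, show Finset.univ.erase (1 : Fin 2) = {0} by decide,
      Finset.prod_singleton]
  rw [stick_eq, OrMap_ins_unlabel, Fin.sum_univ_two, key 0 1 _ (by simp) h0,
    key 1 0 _ (by simp) h1, neg_smul, two_smul, neg_add]

/-- The cocycle condition equates $\bullet\!\!-\!\!\bullet\circ\gamma$ with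
$\gamma\circ\bullet\!\!-\!\!\bullet$. The former evaluates to zero because the inserted stick gives
$-[\![P,P]\!]$; the latter gives $-2[\![P,\mathrm{Or}(\gamma)(P)]\!]$. -/
theorem schouten_OrMap_eq_zero {p : evenMulti (Pt d)} (hp : IsPoisson (p : Multi (Pt d)))
    {γ : Gra} (hγ : γ ∈ cocycles) :
    schouten (p : Multi (Pt d)) (OrMap (p : Multi (Pt d)) γ) = 0 := by
  have h := (mem_cocycles.1 hγ).2
  rw [bracket_even_right stick (cocycles_le_evenGra hγ), sub_eq_zero] at h
  have h2 := OrMap_ins_stick hp.1 γ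
  rw [← h, OrMap_ins_eq_zero (by rw [OrMap_stick hp.1, hp.2, neg_zero])] at h2
  exact (smul_eq_zero.1 h2.symm).resolve_left (by norm_num)

/-- On even graphs the bracket is the difference of the two insertions, each of which evaluates to
one of the two velocities. -/
theorem OrMap_bracket_isFlowCommutator {p : evenMulti (Pt d)}
    (hp : (p : Multi (Pt d)) ∈ bivectors (Pt d)) {γ₁ γ₂ : Gra} (h₁ : γ₁ ∈ cocycles)
    (h₂ : γ₂ ∈ cocycles) :
    IsFlowCommutator (fun P' => OrMap P' γ₁) (fun P' => OrMap P' γ₂) (p : Multi (Pt d))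
      (OrMap (p : Multi (Pt d)) (bracket γ₁ γ₂)) := by
  have he : ∀ {γ}, γ ∈ cocycles → OrMap (p : Multi (Pt d)) γ ∈ evenMulti (Pt d) := fun hγ =>
    bivectors_le_evenMulti (OrMap_mem_bivectors hp (mem_cocycles.1 hγ).1)
  refine ⟨_, _, hasVelocity_OrMap γ₁ γ₂ p (he h₁), hasVelocity_OrMap γ₂ γ₁ p (he h₂), ?_⟩
  rw [bracket_even_right _ (cocycles_le_evenGra h₂), map_sub]

end GraphDegree

end GraphOr

end

theorem mainTheorem4 (d : ℕ) (P : GraphOr.Multi (GraphOr.Pt d)) (hP : GraphOr.IsPoisson P) :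
    -- the domain is a Lie superalgebra (concentrated in even degree) under the graph bracket
    (∀ γ₁ ∈ GraphOr.cocycles, ∀ γ₂ ∈ GraphOr.cocycles,
      GraphOr.bracket γ₁ γ₂ ∈ GraphOr.cocycles) ∧
    (∀ j k : ℕ, ∀ γ₁ ∈ GraphOr.homogeneous (j + 1) (2 * j),
      ∀ γ₂ ∈ GraphOr.homogeneous (k + 1) (2 * k),
      GraphOr.bracket γ₁ γ₂ ∈ GraphOr.homogeneous (j + k + 1) (2 * (j + k))) ∧
    (∀ γ₁ ∈ GraphOr.cocycles, ∀ γ₂ ∈ GraphOr.cocycles,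
      GraphOr.bracket γ₁ γ₂ = -GraphOr.bracket γ₂ γ₁) ∧
    (∀ γ₁ ∈ GraphOr.cocycles, ∀ γ₂ ∈ GraphOr.cocycles, ∀ γ₃ ∈ GraphOr.cocycles,
      GraphOr.bracket γ₁ (GraphOr.bracket γ₂ γ₃) =
        GraphOr.bracket (GraphOr.bracket γ₁ γ₂) γ₃ +
          GraphOr.bracket γ₂ (GraphOr.bracket γ₁ γ₃)) ∧
    -- the linear map `γ ↦ Or(γ)(P)` takes cocycles to Poisson cocycles
    (∀ γ ∈ GraphOr.cocycles, GraphOr.OrMap P γ ∈ GraphOr.bivectors (GraphOr.Pt d) ∧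
      GraphOr.schouten P (GraphOr.OrMap P γ) = 0) ∧
    -- it takes the graph bracket to the commutator of flows
    (∀ γ₁ ∈ GraphOr.cocycles, ∀ γ₂ ∈ GraphOr.cocycles,
      GraphOr.IsFlowCommutator (fun P' => GraphOr.OrMap P' γ₁) (fun P' => GraphOr.OrMap P' γ₂) P
        (GraphOr.OrMap P (GraphOr.bracket γ₁ γ₂))) := by
  have hP' := GraphOr.bivectors_le_evenMulti hP.1
  -- A bi-vector is even, so it may be treated as an element of the commutative ring of even
  -- superfunctions.
  lift P to GraphOr.evenMulti (GraphOr.Pt d) using hP'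
  refine ⟨fun γ₁ h₁ γ₂ h₂ => GraphOr.bracket_mem_cocycles h₁ h₂,
    fun j k γ₁ h₁ γ₂ h₂ => GraphOr.bracket_mem_homogeneous h₁ h₂,
    fun γ₁ _ γ₂ h₂ => GraphOr.bracket_skew γ₁ (GraphOr.cocycles_le_evenGra h₂),
    fun γ₁ _ γ₂ h₂ γ₃ h₃ => GraphOr.bracket_jacobi γ₁ (GraphOr.cocycles_le_evenGra h₂)
      (GraphOr.cocycles_le_evenGra h₃),
    fun γ h => ⟨GraphOr.OrMap_mem_bivectors hP.1 (GraphOr.mem_cocycles.1 h).1,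
      GraphOr.schouten_OrMap_eq_zero hP h⟩,
    fun γ₁ h₁ γ₂ h₂ => GraphOr.OrMap_bracket_isFlowCommutator hP.1 h₁ h₂⟩
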